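/- **Automaton and augmented states.** Let $\mathcal A$ be a $(\min,+)$ weighted automaton over a finite alphabet $\Lambda$ with finite state set $Q$, initial state $q_0$ and weights $\mathcal A(p,\sigma,q)\in\mathbb Z\cup\{\infty\}$ ($\infty$ meaning "no transition"). Let $S=\{(q,p,T): T\subseteq Q,\ q,p\in T\}$ ($q$ the inner state, $p$ the baseline component, $T$ the reachable set), $s_0=(q_0,q_0,\{q_0\})$, $\mathfrak m=|S|\cdot|S|!$. A state $(p,p,T)$ is a *baseline state*. For $w$ a word over the letters below, $\mathsf{mwt}(s\xrightarrow{w}t)$ is the minimal weight of a run on $w$ from $s$ to $t$ ($\infty$ if there is none), $\mathsf{mwt}(s\xrightarrow{w}S)=\min_t\mathsf{mwt}(s\xrightarrow{w}t)$, and $\delta(X,w)$ is the set of states reachable from $X$ on $w$. Let $\delta_{\rm gh}(s_0,w)=\{(p,q,T): p\in T,\ (p',q,T)\in\delta(s_0,w)\text{ for some }p'\}$, $\mathbf c_w(t)=\mathsf{mwt}(s_0\xrightarrow{w}t)$, and $\mathrm{supp}(\mathbf c)=\{t:\mathbf c(t)<\infty\}$. **Letters.** Letters and their transitions are defined by simultaneous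 recursion; transitions not listed have weight $\infty$. * *Base letters* $(p,\sigma,c,q)$ with $c=\mathcal A(p,\sigma,q)$: for each transition of weight $c'=\mathcal A(p_1,\sigma,p_2)<\infty$ (and $c<\infty$), the weight of $(p_1,p,T)\to(p_2,q,\delta_{\mathcal A}(T,\sigma))$ is $c'-c$, where $\delta_{\mathcal A}(T,\sigma)$ is the set of states of $\mathcal A$ reachable from $T$ on $\sigma$. * *Cactus letters* $\alpha_{S',w}$: for $s,r\in S'$ the weight of $s\to r$ is $\min_g\big(\mathsf{mwt}(s\xrightarrow{w^{\mathfrak m}}g)+\mathsf{mwt}(g\xrightarrow{w^{\mathfrak m}}r)\big)$ over the minimal reflexive states $g$ of $(S',w^{\mathfrak m})$. Here $g\in S'$ is *reflexive* on $(S',w)$ if $\mathsf{mwt}(g\xrightarrow{w}g)<\infty$, and *minimal* reflexive if moreover $\mathsf{mwt}(g\xrightarrow{w}g)\le\mathsf{mwt}(g'\xrightarrow{w}g')$ for all reflexive $g'$. The pair $(s,r)$ is *grounded* if this weight is finite. * *Rebase letters* $\beta_{S',w,s\to r}$ for a grounded pair $s=(q_1,p,T)$, $r=(q_2,p,T)$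 of $\alpha_{S',w}$: the weight of $(q',q_1,T)\to(q'',q_2,T)$ is $d-c$, where $c,d$ are the weights on $\alpha_{S',w}$ of $s\to r$ and of $(q',p,T)\to(q'',p,T)$. * *Jump letters* $\mathsf{jump}_{(\cdot,p_1,T)\to(\cdot,p_2,T)}$ with $p_1,p_2\in T$: the weight of $(q,p_1,T)\to(q,p_2,T)$ is $0$. The depth $\mathsf{dep}$ of base and jump letters is $0$, that of $\alpha_{S',w}$ and $\beta_{S',w,s\to r}$ is $1+\mathsf{dep}(w)$, and that of a word is the maximum over its letters ($0$ for the empty word). Let $\mathrm{maxeff}(w)$ be the sum, over the letters of $w$, of the maximal absolute value of a finite transition weight on the letter. **Stable cycles.** $(S',w)$ is a *stable cycle* if $S'=\{(p,q,T):p\in T\}$ for some $T\subseteq Q$ and $q\in T$, $\delta(S',w)\subseteq S'$, and for every $n\in\mathbb N$ the baseline state $s=(q,q,T)$ of $S'$ is a minimal reflexive state of $(S',w^n)$ with $\mathsf{mwt}(s\xrightarrow{w^n}s)=0$. It is *degenerate* if every pair $(s,t)\in S'\times S'$ with $\mathsf{mwt}(t\xrightarrow{w^{2\mathfrak m}}t)<\infty$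 and $\mathsf{mwt}(s\xrightarrow{w^{2\mathfrak m k}}t)<\infty$ for some $k\ge1$ is grounded for $\alpha_{S',w}$. **Length bounds.** Fix $b\in\mathbb N$ and parameters $h\in\mathbb N$, $m\in\{0,1\}$. Let $N=|S|$ and let $\mathrm{MaxW}(0)$ be the maximal absolute value of a finite weight of a base letter. Let $\mathrm{Len}(0,i)=1$ and, for $d\ge1$ and $0\le i\le N$, let $\mathrm{Len}(d,N+1)=b$, $\mathrm{Cov}(d,N)=1$, and $$\mathrm{Len}(d,i)=32\mathfrak m^2\,\mathrm{Len}(d-1,1)\,\mathrm{Len}(d,i+1)\,\big(\mathrm{Ram}(\mathrm{Typ}(d,i),3)+2\big)^{2\mathrm{Amp}(d,i)+1},$$ $$\mathrm{Cov}(d,i)=8\mathfrak m^2\big(\mathrm{MaxW}(d-1)\mathrm{Len}(d-1,1)\mathrm{Len}(d,i+1)+\mathrm{Cov}(d,i+1)+h\big)\quad(i<N),$$ $$\mathrm{Typ}(d,i)=3^i\big(2\mathrm{Cov}(d,i)+2\big)^{2Ni},\qquad \mathrm{MaxW}(d)=2\mathfrak m\,\mathrm{MaxW}(d-1)\,\mathrm{Len}(d,m),$$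 $$\mathrm{Amp}(d,i)=32\mathfrak m^2\big(h+2\mathrm{MaxW}(d-1)\big)\big(\mathrm{Ram}(\mathrm{Typ}(d,i),3)+\mathrm{Len}(d,i+1)+\mathrm{Len}(d-1,1)\big),$$ where $\mathrm{Ram}(k,n)$ is the least $R$ such that every $k$-colouring of the pairs of an $R$-element set has a monochromatic subset of size at least $n$. Let $L_{\rm simp}(d)=\mathrm{Len}(d,1)$ for $h=0$, $m=1$; let $H$ be the value $\mathrm{Amp}(|S|,0)$ for these parameters; and let $L_{\rm gen}(d)=\mathrm{Len}(d,1)$ for $h=H$, $m=0$. **Alphabets.** For a function $L$, let $\mathrm{Cac}_L$ be the set of base letters and cactus letters of depth at most $|S|-1$ such that the letter itself (if it is a cactus letter) and every cactus letter $\alpha_{S',w}$ nested in it satisfies $|w|\le L(\mathsf{dep}(w)+1)$ and $(S',w)$ is a non-degenerate stable cycle, and all innermost letters are base letters. Let $\mathrm{CacReb}_L$ be $\mathrm{Cac}_L$ together with all rebase letters $\beta_{S',w,s\to r}$ with $\alpha_{S',w}\in\mathrm{Cac}_L$ and $(s,r)$ grounded. Let $\mathrm{CacRebCac}_L$ be the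 set of $\alpha_{S',w}$ with $w\in\mathrm{CacReb}_L^*$, $|w|\le L(\mathsf{dep}(w)+1)$ and $(S',w)$ a stable cycle. Let $\mathcal Z=(\mathrm{CacReb}_{L_{\rm simp}}\cup\{\text{jump letters}\})^*\,\mathrm{CacRebCac}_{L_{\rm gen}}$. **Potential.** A state $q$ with $\mathbf c(q)<\infty$ is *dominant* in $\mathbf c$ if some $z\in\mathcal Z$ satisfies $\mathsf{mwt}(q\xrightarrow{z}S)<\infty$ and $\mathsf{mwt}(p\xrightarrow{z}S)=\infty$ for every $p$ with $\mathbf c(p)<\mathbf c(q)$. The potential $\phi(w)$ is the maximum of $\mathbf c_w(q)$ over the states $q$ that are dominant in $\mathbf c_w$ ($-\infty$ if there are none). **Positive simple separated repeating infix (SSRI).** A word $uxyv\in\mathrm{Cac}_{L_{\rm simp}}^*$, given with its factorisation, is an *SSRI* if: 1. $\mathrm{supp}(\mathbf c_u)=\mathrm{supp}(\mathbf c_{ux})=\mathrm{supp}(\mathbf c_{uxy})=:B$; 2. $|x|\le\frac1{\mathfrak m}L_{\rm simp}(\mathsf{dep}(x)+1)$; 3. $B$ has a partition into nonempty sets $V_1,\dots,V_\ell$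 and there are integers $k_{j,x},k_{j,y}$, of equal sign ($+$, $0$ or $-$) for each $j$, such that $\mathbf c_{ux}(s)=\mathbf c_u(s)+k_{j,x}$ and $\mathbf c_{uxy}(s)=\mathbf c_{ux}(s)+k_{j,y}$ for all $s\in V_j$, and $\mathbf c_\xi(s')-\mathbf c_\xi(s)>4|S|\,\mathfrak m\,\mathrm{maxeff}(xy)$ for all $j<\ell$, $s\in V_j$, $s'\in V_{j+1}$ and $\xi\in\{u,ux,uxy\}$; 4. there is a run on $uxyv$ from $s_0$ through baseline states such that, after every prefix, the weight accumulated by the run is the minimal weight of any run from $s_0$ on that prefix to the current state; 5. $\phi(u)\le\phi(ux)\le\phi(uxy)$, and $\phi(u)=\phi(ux)$ if and only if $\phi(ux)=\phi(uxy)$. It is *Positive* if the partition can be taken with all $k_{j,x},k_{j,y}\ge0$. **Type-0 witness.** A *type-0 witness* consists of $w_1\in\mathrm{Cac}_{L_{\rm simp}}^*$, a letter $\alpha_{S_1,w_2}\in\mathrm{Cac}_{L_{\rm simp}}$ with $S_1=\delta_{\rm gh}(s_0,w_1)$, and $w_3\in\mathcal Z$ such that $$\delta(s_0,w_1)=\delta(s_0,w_1w_2^{2\mathfrak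 m}),\qquad \mathsf{mwt}(s_0\xrightarrow{w_1w_2^{2\mathfrak m}w_3}S)<\infty,\qquad \mathsf{mwt}(s_0\xrightarrow{w_1\alpha_{S_1,w_2}w_3}S)=\infty.$$ **Lemma.** For every such $\mathcal A$, every $b\in\mathbb N$ and every Positive SSRI $uxyv$, either $(\delta_{\rm gh}(s_0,u),x)$ is a stable cycle or there is a type-0 witness. -/

import Mathlib

open scoped BigOperators

namespace Cactus

/-! ### Weighted automata and the state space of the baseline-augmented construction -/

/-- A `(min,+)` weighted automaton with state set `Q` over the alphabet `Λ`: an initial state, and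
for all `p, σ, q` exactly one weight in `ℤ ∪ {∞}` (weight `⊤` means that there is no transition). -/
structure WFA (Q Λ : Type*) where
  init : Q
  wt : Q → Λ → Q → WithTop ℤ

/-- States `(q, p, T)` with `q, p ∈ T`: inner state `q`, baseline component `p` and
reachable set `T`. -/
abbrev State (Q : Type*) := {x : Q × Q × Finset Q // x.1 ∈ x.2.2 ∧ x.2.1 ∈ x.2.2}

section StateOps

variable {Q : Type*}

def State.inner (s : State Q) : Q := s.1.1

def State.base (s : State Q) : Q := s.1.2.1

def State.reach (s : State Q) : Finset Q := s.1.2.2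

/-- A baseline state is one of the form `(p, p, T)`. -/
def State.IsBaseline (s : State Q) : Prop := s.inner = s.base

/-- Replace the baseline component of `(q, p, T)` by `p' ∈ T`. -/
def State.withBase (s : State Q) (p : Q) (hp : p ∈ s.reach) : State Q :=
  ⟨(s.inner, p, s.reach), s.2.1, hp⟩

/-- The set `{(p, q, T) | p ∈ T}`. -/
def fiber (q : Q) (T : Finset Q) : Set (State Q) := {s | s.base = q ∧ s.reach = T}

end StateOps

/-- The letters. `base p σ q` is the transition `(p, σ, c, q)` of the automaton (the weight `c`
is determined by the automaton); `cactus S' w` is `α_{S',w}`; `rebase S' w s r` is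
`β_{S',w,s→r}`; `jump T p₁ p₂` is `jump_{(·,p₁,T)→(·,p₂,T)}`. Which of these expressions
are actual letters of an alphabet is governed by the alphabets defined below. -/
inductive Letter (Q Λ : Type*) where
  | base (p : Q) (σ : Λ) (q : Q) : Letter Q Λ
  | cactus (S' : Set (State Q)) (w : List (Letter Q Λ)) : Letter Q Λ
  | rebase (S' : Set (State Q)) (w : List (Letter Q Λ)) (s r : State Q) : Letter Q Λ
  | jump (T : Finset Q) (p₁ p₂ : Q) : Letter Q Λ

abbrev Word (Q Λ : Type*) := List (Letter Q Λ)

/-- The word `w ^ n`. -/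
def wpow {α : Type*} (w : List α) (n : ℕ) : List α := (List.replicate n w).flatten

mutual

/-- The nesting depth of a letter. -/
def Letter.depth {Q Λ : Type*} : Letter Q Λ → ℕ
  | .base _ _ _ => 0
  | .cactus _ w => 1 + wordDepth w
  | .rebase _ w _ _ => 1 + wordDepth w
  | .jump _ _ _ => 0

/-- The depth of a word: the maximal depth of a letter in it. -/
def wordDepth {Q Λ : Type*} : List (Letter Q Λ) → ℕ
  | [] => 0
  | a :: w => max (Letter.depth a) (wordDepth w)

end

/-- `a - c`, where an infinite `c` (a missing transition) gives `∞`. -/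
def subWt (a : WithTop ℤ) : WithTop ℤ → WithTop ℤ
  | ⊤ => ⊤
  | (c : ℤ) => a + ((-c : ℤ) : WithTop ℤ)

noncomputable section

section Automaton

variable {Q Λ : Type*} [Fintype Q] [DecidableEq Q]

/-- `|S|`, the number of states of the augmented automaton. -/
def numStates (Q : Type*) [Fintype Q] [DecidableEq Q] : ℕ := Fintype.card (State Q)

/-- The stabilisation constant `𝔪 = |S| · |S|!`. -/
def bigM (Q : Type*) [Fintype Q] [DecidableEq Q] : ℕ := numStates Q * (numStates Q).factorial

open Classical in
/-- The states of the original automaton reachable from `T` on the letter `σ`. -/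
def WFA.succ (A : WFA Q Λ) (T : Finset Q) (σ : Λ) : Finset Q :=
  Finset.univ.filter fun q => ∃ p ∈ T, A.wt p σ q ≠ ⊤

/-- The initial state `(q₀, q₀, {q₀})`. -/
def WFA.start (A : WFA Q Λ) : State Q := ⟨(A.init, A.init, {A.init}), by simp⟩

/-! ### Transition weights -/

/-- Weight matrices over the state space, with entries in `ℤ ∪ {∞}`. -/
abbrev WtMat (Q : Type*) := State Q → State Q → WithTop ℤ

def WtMat.one : WtMat Q := fun s t => if s = t then 0 else ⊤

/-- The `(min,+)` product. -/
def WtMat.mul (m m' : WtMat Q) : WtMat Q := fun s t => Finset.univ.inf fun r => m s r + m' r t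

def WtMat.pow (m : WtMat Q) : ℕ → WtMat Q
  | 0 => WtMat.one
  | n + 1 => WtMat.mul m (WtMat.pow m n)

/-- The states of `S'` whose self-loop has finite and minimal weight among the self-loops on
`S'`. -/
def WtMat.minStates (m : WtMat Q) (S' : Set (State Q)) : Set (State Q) :=
  {s | s ∈ S' ∧ m s s ≠ ⊤ ∧ ∀ r ∈ S', m r r ≠ ⊤ → m s s ≤ m r r}

open Classical in
/-- Weights of the letter `(p, σ, c, q)`: from `(p₁, p, T)` to `(p₂, q, δ(T, σ))` the weight is
`c' - c`, where `c'` is the weight of the transition from `p₁` to `p₂` on `σ`. -/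
def baseMat (A : WFA Q Λ) (p : Q) (σ : Λ) (q : Q) : WtMat Q := fun s t =>
  if s.base = p ∧ t.base = q ∧ t.reach = A.succ s.reach σ then
    subWt (A.wt s.inner σ t.inner) (A.wt p σ q)
  else ⊤

open Classical in
/-- Weights of a cactus letter over `S'`, computed from the matrix `m` of `w ^ 𝔪`: for `s, r` in
`S'`, the minimum over the minimal reflexive states `g` of the weight of `s → g → r`. -/
def cactusMat (S' : Set (State Q)) (m : WtMat Q) : WtMat Q := fun s r =>
  if s ∈ S' ∧ r ∈ S' then
    (Finset.univ.filter fun g => g ∈ m.minStates S').inf fun g => m s g + m g r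
  else ⊤

open Classical in
/-- Weights of a rebase letter with `s = (q₁, p, T)`, `r = (q₂, p, T)`, computed from the matrix
`m` of the cactus letter: from `(q', q₁, T)` to `(q'', q₂, T)` the weight is `d - c`, where `c` is
the weight from `s` to `r` and `d` is the weight from `(q', p, T)` to `(q'', p, T)`. -/
def rebaseMat (s r : State Q) (m : WtMat Q) : WtMat Q := fun t t' =>
  if h : t.reach = s.reach ∧ t'.reach = s.reach ∧ t.base = s.inner ∧ t'.base = r.inner then
    subWt (m (t.withBase s.base (h.1.symm ▸ s.2.2)) (t'.withBase s.base (h.2.1.symm ▸ s.2.2)))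
      (m s r)
  else ⊤

/-- Weights of a jump letter: from `(q, p₁, T)` to `(q, p₂, T)` the weight is `0`. -/
def jumpMat (T : Finset Q) (p₁ p₂ : Q) : WtMat Q := fun s t =>
  if s.reach = T ∧ t.reach = T ∧ s.base = p₁ ∧ t.base = p₂ ∧ s.inner = t.inner then 0 else ⊤

mutual

/-- The transition weights of a letter. -/
def letterWt (A : WFA Q Λ) : Letter Q Λ → WtMat Q
  | .base p σ q => baseMat A p σ q
  | .cactus S' w => cactusMat S' (WtMat.pow (mwt A w) (bigM Q))
  | .rebase S' w s r => rebaseMat s r (cactusMat S' (WtMat.pow (mwt A w) (bigM Q)))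
  | .jump T p₁ p₂ => jumpMat T p₁ p₂

/-- `mwt A w s t` is the minimal weight of a run on `w` from `s` to `t` (`⊤` if there is none);
see `mwt_le_of_isRun` and `exists_isRun_of_mwt`. -/
def mwt (A : WFA Q Λ) : List (Letter Q Λ) → WtMat Q
  | [] => WtMat.one
  | a :: w => WtMat.mul (letterWt A a) (mwt A w)

end

/-! ### Runs -/

/-- `IsRun A s w c t`: there is a run on `w` from `s` to `t` of (finite) weight `c`. -/
inductive IsRun (A : WFA Q Λ) : State Q → Word Q Λ → ℤ → State Q → Prop
  | nil (s : State Q) : IsRun A s [] 0 s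
  | cons {s r t : State Q} {a : Letter Q Λ} {w : Word Q Λ} {c d : ℤ} :
      letterWt A a s r = (c : WithTop ℤ) → IsRun A r w d t → IsRun A s (a :: w) (c + d) t

theorem mwt_le_of_isRun (A : WFA Q Λ) {s t : State Q} {w : Word Q Λ} {c : ℤ}
    (h : IsRun A s w c t) : mwt A w s t ≤ (c : WithTop ℤ) := by
  induction h with
  | nil s => simp [mwt, WtMat.one]
  | @cons s r t a w c d h1 _ ih =>
    rw [mwt, WtMat.mul]
    refine (Finset.inf_le (Finset.mem_univ r)).trans ?_
    rw [h1]
    push_cast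
    exact add_le_add le_rfl ih

theorem exists_isRun_of_mwt (A : WFA Q Λ) {w : Word Q Λ} {s t : State Q} {c : ℤ}
    (h : mwt A w s t = (c : WithTop ℤ)) : IsRun A s w c t := by
  induction w generalizing s c with
  | nil =>
    rw [mwt, WtMat.one] at h
    split_ifs at h with hst
    · subst hst
      have : c = 0 := by exact_mod_cast h.symm
      subst this
      exact IsRun.nil s
    · exact absurd h (by simp)
  | cons a w ih =>
    rw [mwt, WtMat.mul] at h
    obtain ⟨r, -, hr⟩ := Finset.exists_mem_eq_inf (Finset.univ : Finset (State Q)) ⟨s, by simp⟩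
      (fun r => letterWt A a s r + mwt A w r t)
    rw [hr] at h
    obtain ⟨x, y, hx, hy, hxy⟩ := WithTop.add_eq_coe.1 h
    subst hxy
    exact IsRun.cons hx.symm (ih hy.symm)

theorem WtMat.one_mul (m : WtMat Q) : WtMat.mul WtMat.one m = m := by
  funext s t
  refine le_antisymm ?_ ?_
  · refine (Finset.inf_le (Finset.mem_univ s)).trans ?_
    simp [WtMat.one]
  · refine Finset.le_inf fun r _ => ?_
    by_cases h : s = r
    · subst h; simp [WtMat.one]
    · simp [WtMat.one, h]

theorem WtMat.mul_assoc (m₁ m₂ m₃ : WtMat Q) :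
    WtMat.mul (WtMat.mul m₁ m₂) m₃ = WtMat.mul m₁ (WtMat.mul m₂ m₃) := by
  funext s t
  refine le_antisymm ?_ ?_
  · refine Finset.le_inf fun r _ => ?_
    obtain ⟨q, -, hq⟩ := Finset.exists_mem_eq_inf (Finset.univ : Finset (State Q)) ⟨s, by simp⟩
      (fun q => m₂ r q + m₃ q t)
    have hq' : WtMat.mul m₂ m₃ r t = m₂ r q + m₃ q t := hq
    rw [hq', ← add_assoc]
    refine (Finset.inf_le (Finset.mem_univ q)).trans ?_
    exact add_le_add (Finset.inf_le (f := fun r => m₁ s r + m₂ r q) (Finset.mem_univ r)) le_rfl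
  · refine Finset.le_inf fun q _ => ?_
    obtain ⟨r, -, hr⟩ := Finset.exists_mem_eq_inf (Finset.univ : Finset (State Q)) ⟨s, by simp⟩
      (fun r => m₁ s r + m₂ r q)
    have hr' : WtMat.mul m₁ m₂ s q = m₁ s r + m₂ r q := hr
    rw [hr', add_assoc]
    refine (Finset.inf_le (Finset.mem_univ r)).trans ?_
    exact add_le_add le_rfl (Finset.inf_le (f := fun q => m₂ r q + m₃ q t) (Finset.mem_univ q))

theorem mwt_append (A : WFA Q Λ) (w w' : Word Q Λ) :
    mwt A (w ++ w') = WtMat.mul (mwt A w) (mwt A w') := by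
  induction w with
  | nil => simp [mwt, WtMat.one_mul]
  | cons a w ih => rw [List.cons_append, mwt, ih, mwt, WtMat.mul_assoc]

theorem mwt_wpow (A : WFA Q Λ) (w : Word Q Λ) (n : ℕ) :
    mwt A (wpow w n) = WtMat.pow (mwt A w) n := by
  induction n with
  | zero => simp [wpow, mwt, WtMat.pow]
  | succ n ih =>
    have : wpow w (n + 1) = w ++ wpow w n := by simp [wpow, List.replicate_succ]
    rw [this, mwt_append, ih, WtMat.pow]

/-- `mwt(s →w S)`. -/
def mwtOut (A : WFA Q Λ) (w : Word Q Λ) (s : State Q) : WithTop ℤ :=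
  Finset.univ.inf fun t => mwt A w s t

/-- `δ_𝔹(S', w)`: the states reachable from `S'` on `w`. -/
def reachSet (A : WFA Q Λ) (S' : Set (State Q)) (w : Word Q Λ) : Set (State Q) :=
  {t | ∃ s ∈ S', mwt A w s t ≠ ⊤}

/-- The ghost-reachable states after `w` from the initial state: all `(p, q, T)` with `p ∈ T`,
where `(q, T)` are the last two components of the states in `δ_𝔹(s₀, w)`. -/
def ghost (A : WFA Q Λ) (w : Word Q Λ) : Set (State Q) :=
  {t | ∃ r ∈ reachSet A {A.start} w, t.base = r.base ∧ t.reach = r.reach}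

/-- The configuration after `w` from the initial state: the state `q` gets the minimal weight of
a run on `w` from `s₀` to `q`. -/
def conf (A : WFA Q Λ) (w : Word Q Λ) : State Q → WithTop ℤ := fun q => mwt A w A.start q

def supp (c : State Q → WithTop ℤ) : Set (State Q) := {q | c q ≠ ⊤}

/-- The maximal absolute value of a finite weight of a transition on the letter `a`. -/
def wmax (A : WFA Q Λ) (a : Letter Q Λ) : ℕ :=
  Finset.univ.sup fun st : State Q × State Q => (WithTop.untopD 0 (letterWt A a st.1 st.2)).natAbs

/-- The maximal effect of a word: the sum of `wmax` over its letters. -/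
def maxeff (A : WFA Q Λ) (w : Word Q Λ) : ℕ := (w.map (wmax A)).sum

/-- There is a run on `w` from the initial state through baseline states which after every prefix
has the minimal weight (`c i` is its weight after `i` letters) with which its current state is
reachable. -/
def HasSeamlessBaselineRun (A : WFA Q Λ) (w : Word Q Λ) : Prop :=
  ∃ (ρ : ℕ → State Q) (c : ℕ → ℤ), ρ 0 = A.start ∧ c 0 = 0 ∧ (∀ i ≤ w.length, (ρ i).IsBaseline) ∧
    ∀ (i : ℕ) (hi : i < w.length),
      (∃ d : ℤ, letterWt A w[i] (ρ i) (ρ (i + 1)) = (d : WithTop ℤ) ∧ c (i + 1) = c i + d) ∧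
      mwt A (w.take (i + 1)) A.start (ρ (i + 1)) = (c (i + 1) : WithTop ℤ)

/-! ### Reflexive cycles, stable cycles and grounded pairs -/

def IsReflexiveCycle (A : WFA Q Λ) (S' : Set (State Q)) (w : Word Q Λ) : Prop :=
  (∃ q T, q ∈ T ∧ S' = fiber q T) ∧ reachSet A S' w ⊆ S'

/-- The reflexive states of `(S', w)`. -/
def refStates (A : WFA Q Λ) (S' : Set (State Q)) (w : Word Q Λ) : Set (State Q) :=
  {s | s ∈ S' ∧ mwt A w s s ≠ ⊤}

/-- The minimal reflexive states of `(S', w)`. -/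
def minStates (A : WFA Q Λ) (S' : Set (State Q)) (w : Word Q Λ) : Set (State Q) :=
  {s | s ∈ refStates A S' w ∧ ∀ r ∈ refStates A S' w, mwt A w s s ≤ mwt A w r r}

/-- `(S', w)` is a stable cycle: a reflexive cycle whose baseline state is, for every `n`, a
minimal reflexive state of `(S', w ^ n)` with a cycle of weight `0`. -/
def IsStableCycle (A : WFA Q Λ) (S' : Set (State Q)) (w : Word Q Λ) : Prop :=
  IsReflexiveCycle A S' w ∧ ∀ s ∈ S', s.IsBaseline → ∀ n : ℕ,
    s ∈ minStates A S' (wpow w n) ∧ mwt A (wpow w n) s s = 0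

/-- The grounded pairs of `(S', w)`. -/
def grnPairs (A : WFA Q Λ) (S' : Set (State Q)) (w : Word Q Λ) : Set (State Q × State Q) :=
  {p | p.1 ∈ S' ∧ p.2 ∈ S' ∧ ∃ g ∈ minStates A S' (wpow w (bigM Q)),
    mwt A (wpow w (bigM Q)) p.1 g ≠ ⊤ ∧ mwt A (wpow w (bigM Q)) g p.2 ≠ ⊤}

/-- A stable cycle is degenerate if all pairs `(s, t)` with `t` reflexive on `w ^ (2𝔪)` and
reachable from `s` on some `w ^ (2𝔪k)`, `k ≥ 1`, are grounded. -/
def IsDegenerate (A : WFA Q Λ) (S' : Set (State Q)) (w : Word Q Λ) : Prop :=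
  ∀ s ∈ S', ∀ t ∈ refStates A S' (wpow w (2 * bigM Q)),
    (∃ k ≥ 1, mwt A (wpow w (2 * bigM Q * k)) s t ≠ ⊤) → (s, t) ∈ grnPairs A S' w

open Classical in
/-- The weights of a cactus letter in terms of runs on `w ^ 𝔪`. -/
theorem letterWt_cactus (A : WFA Q Λ) (S' : Set (State Q)) (w : Word Q Λ) (s r : State Q) :
    letterWt A (.cactus S' w) s r =
      if s ∈ S' ∧ r ∈ S' then
        (Finset.univ.filter fun g => g ∈ minStates A S' (wpow w (bigM Q))).inf fun g =>
          mwt A (wpow w (bigM Q)) s g + mwt A (wpow w (bigM Q)) g r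
      else ⊤ := by
  have h : ∀ g, g ∈ (WtMat.pow (mwt A w) (bigM Q)).minStates S' ↔
      g ∈ minStates A S' (wpow w (bigM Q)) := by
    intro g
    simp only [WtMat.minStates, minStates, refStates, mwt_wpow, Set.mem_ofPred_eq]
    tauto
  simp only [letterWt, cactusMat, mwt_wpow, h]

/-- A cactus letter has a transition from `s` to `r` iff `(s, r)` is a grounded pair. -/
theorem letterWt_cactus_ne_top (A : WFA Q Λ) (S' : Set (State Q)) (w : Word Q Λ)
    (s r : State Q) : letterWt A (.cactus S' w) s r ≠ ⊤ ↔ (s, r) ∈ grnPairs A S' w := by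
  classical
  rw [letterWt_cactus]
  split_ifs with h
  · simp only [ne_eq, Finset.inf_eq_top_iff, grnPairs, Set.mem_ofPred_eq, Finset.mem_filter,
      Finset.mem_univ, true_and, WithTop.add_eq_top, not_forall, not_or, exists_prop, h.1, h.2]
  · simp only [ne_eq, not_true_eq_false, grnPairs, Set.mem_ofPred_eq, false_iff]
    tauto

/-! ### Effective alphabets -/

/-- The cactus letters all of whose nested words `w` satisfy `|w| ≤ L (dep w + 1)` and all of
whose nested cycles are stable and non-degenerate. -/
inductive IsBoundedCactus (A : WFA Q Λ) (L : ℕ → ℕ) : Letter Q Λ → Prop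
  | base (p : Q) (σ : Λ) (q : Q) : IsBoundedCactus A L (.base p σ q)
  | cactus (S' : Set (State Q)) (w : Word Q Λ) : (∀ a ∈ w, IsBoundedCactus A L a) →
      w.length ≤ L (wordDepth w + 1) → IsStableCycle A S' w → ¬ IsDegenerate A S' w →
      IsBoundedCactus A L (.cactus S' w)

/-- The bounded cactus letters: those of depth at most `|S| - 1`. -/
def bddCac (A : WFA Q Λ) (L : ℕ → ℕ) : Set (Letter Q Λ) :=
  {a | IsBoundedCactus A L a ∧ a.depth ≤ numStates Q - 1}

/-- The bounded cactus letters together with their rebase letters. -/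
def bddCacReb (A : WFA Q Λ) (L : ℕ → ℕ) : Set (Letter Q Λ) :=
  bddCac A L ∪ {a | ∃ S' w s r, a = .rebase S' w s r ∧ .cactus S' w ∈ bddCac A L ∧
    (s, r) ∈ grnPairs A S' w}

/-- The cactus letters obtained by a single stabilisation from words over `bddCacReb A L`. -/
def bddCacRebCac (A : WFA Q Λ) (L : ℕ → ℕ) : Set (Letter Q Λ) :=
  {a | ∃ S' w, a = .cactus S' w ∧ (∀ b ∈ w, b ∈ bddCacReb A L) ∧
    w.length ≤ L (wordDepth w + 1) ∧ IsStableCycle A S' w}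

/-- The jump letters. -/
def jumpLetters (Q Λ : Type*) : Set (Letter Q Λ) :=
  {a | ∃ T p₁ p₂, p₁ ∈ T ∧ p₂ ∈ T ∧ a = .jump T p₁ p₂}

def bddCacRebJump (A : WFA Q Λ) (L : ℕ → ℕ) : Set (Letter Q Λ) :=
  bddCacReb A L ∪ jumpLetters Q Λ

end Automaton

/-! ### The length bounds -/

/-- The least `R` such that every colouring of the 2-element subsets of an `R`-element set with
`k` colours has a monochromatic set of at least `n` elements. -/
def ramsey (k n : ℕ) : ℕ :=
  sInf {R : ℕ | ∀ c : {e : Sym2 (Fin R) // ¬ e.IsDiag} → Fin k,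
    ∃ s : Finset (Fin R), n ≤ s.card ∧
      ∀ e e', (∀ i ∈ e.1, i ∈ s) → (∀ i ∈ e'.1, i ∈ s) → c e = c e'}

/-- Parameters of the recursive bounds: the number `N = |S|` of states, the maximal weight `W₀`
of a letter of depth `0`, the value `b` of `Len(d, |S|+1)` for `d ≥ 1`, the additive constant `h`
(`0` for the simple bounds, `H` for the general ones), and the index `m` used in the recursion for
the maximal weight (`1` for the simple bounds, `0` for the general ones). -/
structure BoundParams where
  N : ℕ
  W₀ : ℕ
  b : ℕ
  h : ℕ
  m : ℕ

def BoundParams.M (P : BoundParams) : ℕ := P.N * P.N.factorial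

mutual

/-- `Len(d, i)`. -/
def lenB (P : BoundParams) : ℕ → ℕ → ℕ
  | 0, _ => 1
  | d + 1, i =>
    if P.N < i then P.b
    else 32 * P.M ^ 2 * lenB P d 1 * lenB P (d + 1) (i + 1) *
      (ramsey (typesB P (d + 1) i) 3 + 2) ^ (2 * ampB P (d + 1) i + 1)
termination_by d i => (d, P.N + 2 - i, 3)

/-- `Cov(d, i)`; equal to `1` for `i = |S|` (the values at `d = 0` and `i > |S|` are not used). -/
def coverB (P : BoundParams) : ℕ → ℕ → ℕ
  | 0, _ => 1
  | d + 1, i =>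
    if P.N ≤ i then 1
    else 8 * P.M ^ 2 *
      (maxWtB P d * lenB P d 1 * lenB P (d + 1) (i + 1) + coverB P (d + 1) (i + 1) + P.h)
termination_by d i => (d, P.N + 2 - i, 0)

/-- `MaxWt(d)`. -/
def maxWtB (P : BoundParams) : ℕ → ℕ
  | 0 => P.W₀
  | d + 1 => 2 * P.M * maxWtB P d * lenB P (d + 1) P.m
termination_by d => (d, P.N + 3, 0)

/-- `Amp(d, i)` (the values at `d = 0` and `i > |S|` are not used). -/
def ampB (P : BoundParams) : ℕ → ℕ → ℕ
  | 0, _ => 0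
  | d + 1, i =>
    if P.N < i then 0
    else 32 * P.M ^ 2 * (P.h + 2 * maxWtB P d) *
      (ramsey (typesB P (d + 1) i) 3 + lenB P (d + 1) (i + 1) + lenB P d 1)
termination_by d i => (d, P.N + 2 - i, 2)

/-- `Typ(d, i)`. -/
def typesB (P : BoundParams) (d i : ℕ) : ℕ :=
  3 ^ i * (2 * coverB P d i + 2) ^ (2 * P.N * i)
termination_by (d, P.N + 2 - i, 1)

end

section Main

variable {Q Λ : Type*} [Fintype Q] [DecidableEq Q] [Fintype Λ]

/-- The maximal weight of a letter of depth `0`. -/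
def maxWt₀ (A : WFA Q Λ) : ℕ :=
  Finset.univ.sup fun x : Q × Λ × Q => wmax A (.base x.1 x.2.1 x.2.2)

def simpParams (A : WFA Q Λ) (b : ℕ) : BoundParams := ⟨numStates Q, maxWt₀ A, b, 0, 1⟩

/-- The constant `H = Amp(|S|, 0)`. -/
def boundH (A : WFA Q Λ) (b : ℕ) : ℕ := ampB (simpParams A b) (numStates Q) 0

def genParams (A : WFA Q Λ) (b : ℕ) : BoundParams := ⟨numStates Q, maxWt₀ A, b, boundH A b, 0⟩

/-- The simple length bound. -/
def simpL (A : WFA Q Λ) (b : ℕ) (d : ℕ) : ℕ := lenB (simpParams A b) d 1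

/-- The general length bound. -/
def genL (A : WFA Q Λ) (b : ℕ) (d : ℕ) : ℕ := lenB (genParams A b) d 1

/-! ### Dominance, potential and witnesses -/

/-- The admissible suffixes: a word over the simple alphabet with rebase and jump letters,
followed by one letter of the general cactus alphabet. -/
def suffixWords (A : WFA Q Λ) (b : ℕ) : Set (Word Q Λ) :=
  {w | ∃ z a, w = z ++ [a] ∧ (∀ e ∈ z, e ∈ bddCacRebJump A (simpL A b)) ∧
    a ∈ bddCacRebCac A (genL A b)}

/-- The state `q`, of finite weight in the configuration `c`, is dominant: some admissible suffix
can be read from `q` but from no state of smaller weight. -/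
def IsDominant (A : WFA Q Λ) (b : ℕ) (c : State Q → WithTop ℤ) (q : State Q) : Prop :=
  q ∈ supp c ∧ ∃ w ∈ suffixWords A b, mwtOut A w q < ⊤ ∧ ∀ p, c p < c q → mwtOut A w p = ⊤

open Classical in
/-- The maximal weight of a dominant state (`⊥` if there is none). -/
def domVal (A : WFA Q Λ) (b : ℕ) (c : State Q → WithTop ℤ) : WithBot (WithTop ℤ) :=
  (Finset.univ.filter fun q => IsDominant A b c q).sup fun q => (c q : WithBot (WithTop ℤ))

/-- The potential of a word. -/
def potential (A : WFA Q Λ) (b : ℕ) (w : Word Q Λ) : WithBot (WithTop ℤ) := domVal A b (conf A w)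

/-- `w₁, α_{S₁,w₂}, w₃` is a witness of type `0`. -/
structure IsWitnessZero (A : WFA Q Λ) (b : ℕ) (w₁ : Word Q Λ) (S₁ : Set (State Q))
    (w₂ w₃ : Word Q Λ) : Prop where
  prefix_mem : ∀ a ∈ w₁, a ∈ bddCac A (simpL A b)
  ghost_eq : S₁ = ghost A w₁
  cactus_mem : .cactus S₁ w₂ ∈ bddCac A (simpL A b)
  suffix_mem : w₃ ∈ suffixWords A b
  cycle : reachSet A {A.start} w₁ = reachSet A {A.start} (w₁ ++ wpow w₂ (2 * bigM Q))
  finite : mwtOut A (w₁ ++ wpow w₂ (2 * bigM Q) ++ w₃) A.start < ⊤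
  infinite : mwtOut A (w₁ ++ [.cactus S₁ w₂] ++ w₃) A.start = ⊤

/-! ### Separated repeating infixes -/

/-- The partition `V₁, …, V_ℓ` of the states reached after `u`, with gaps larger than `G` and
shifts `kx j`, `ky j`. -/
structure IsSeparatedPartition (A : WFA Q Λ) (G : ℕ) (u x y : Word Q Λ) (ℓ : ℕ)
    (V : Fin ℓ → Set (State Q)) (kx ky : Fin ℓ → ℤ) : Prop where
  nonempty : ∀ j, (V j).Nonempty
  disjoint : Pairwise fun i j => Disjoint (V i) (V j)
  union : ⋃ j, V j = supp (conf A u)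
  gap : ∀ i j : Fin ℓ, (j : ℕ) = i + 1 → ∀ s ∈ V i, ∀ s' ∈ V j,
    ∀ ξ ∈ [u, u ++ x, u ++ x ++ y], conf A ξ s + (G : WithTop ℤ) < conf A ξ s'
  shift_x : ∀ j, ∀ s ∈ V j, conf A (u ++ x) s = conf A u s + (kx j : WithTop ℤ)
  shift_y : ∀ j, ∀ s ∈ V j, conf A (u ++ x ++ y) s = conf A (u ++ x) s + (ky j : WithTop ℤ)
  sign_eq : ∀ j, (kx j).sign = (ky j).sign

/-- The gap required in a simple SRI. -/
def simpGap (A : WFA Q Λ) (x y : Word Q Λ) : ℕ := 4 * numStates Q * bigM Q * maxeff A (x ++ y)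

/-- `uxyv` is a simple separated repeating infix (SSRI). -/
structure IsSSRI (A : WFA Q Λ) (b : ℕ) (u x y v : Word Q Λ) : Prop where
  letters : ∀ a ∈ u ++ x ++ y ++ v, a ∈ bddCac A (simpL A b)
  supp_x : supp (conf A (u ++ x)) = supp (conf A u)
  supp_y : supp (conf A (u ++ x ++ y)) = supp (conf A u)
  length_x : (x.length : ℚ) ≤ 1 / (bigM Q : ℚ) * (simpL A b (wordDepth x + 1) : ℚ)
  partition : ∃ ℓ V kx ky, IsSeparatedPartition A (simpGap A x y) u x y ℓ V kx ky
  baseline : HasSeamlessBaselineRun A (u ++ x ++ y ++ v)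
  potential_x : potential A b u ≤ potential A b (u ++ x)
  potential_y : potential A b (u ++ x) ≤ potential A b (u ++ x ++ y)
  potential_eq : potential A b u = potential A b (u ++ x) ↔
    potential A b (u ++ x) = potential A b (u ++ x ++ y)

/-- `uxyv` is a positive SSRI: all the shifts of its partition are nonnegative. -/
def IsPositiveSSRI (A : WFA Q Λ) (b : ℕ) (u x y v : Word Q Λ) : Prop :=
  IsSSRI A b u x y v ∧ ∃ ℓ V kx ky, IsSeparatedPartition A (simpGap A x y) u x y ℓ V kx ky ∧
    ∀ j, 0 ≤ kx j ∧ 0 ≤ ky j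

end Main

end

end Cactus

/-!
The set `S' = ghost A u` is the set of all states `(p, q, T)` whose last two components are those of
the states reached by `u`, and `x` leads from `S'` into `S'`. The baseline run supplies a cycle of
nonpositive weight on `x` through the baseline state, so `(S', x)` is a stable cycle as soon as no
cycle within `S'` on a power of `x` has negative weight.

For cycles through states that are reached by `u` this holds always
(`IsSeparatedPartition.cycle_nonneg`): the gaps of the partition exceed the effect of `x` and no
shift is negative, so a cycle stays within one class, and there the configuration after `u` is a
potential for the weights.

If a cycle through some other state of `S'` has negative weight, choose one of minimal slope
(weight per copy of `x`), say through `r` and on `x ^ n` with `n ≤ |S|`. Rebasing `x ^ n` on this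
cycle gives a stable cycle (`IsRebasedMat.isStableCycle`), whose cactus letter is admissible because
`|x| ≤ L_simp / 𝔪` and `L_simp ≤ L_gen`; the latter, `simpL_le_genL`, uses that the Ramsey numbers
for triangles are finite. A jump to the new baseline followed by this letter is an admissible suffix
that can be read from `r`, but from no state reached by `u`: only cycles of the minimal, negative,
slope ground it (`exists_witness_of_neg_cycle`).

Finally, replace the cactus letters `α_{S₁,w}` of `u` by `w ^ (2𝔪)`, recursively and one after the
other. The completely unfolded word consists of base letters, on which no state of the reachable
set is forgotten; it reaches `r`, so the suffix has become readable. The replacement at which this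
happens yields the witness (`exists_witness_of_unfold`); the remaining part of `u` is prepended to
the suffix, and further copies of `w ^ (2𝔪)` make the set of reachable states stationary.
-/

namespace Cactus

/-! ### Triangle Ramsey numbers and monotonicity of the length bounds -/

/-- The multicolour Ramsey theorem for triangles, by induction on the set of colours: among the
neighbours of a vertex joined to it by a popular colour `k`, either some edge has colour `k`, or
that colour does not occur at all. -/
theorem exists_mono_triangle (C : Finset ℕ) : ∃ R : ℕ, ∀ (V : Finset ℕ) (c : ℕ → ℕ → ℕ),
    (∀ x y, c x y = c y x) → (∀ x ∈ V, ∀ y ∈ V, x ≠ y → c x y ∈ C) → R ≤ V.card →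
    ∃ x ∈ V, ∃ y ∈ V, ∃ z ∈ V, x ≠ y ∧ x ≠ z ∧ y ≠ z ∧ c x y = c x z ∧ c x y = c y z := by
  induction hn : C.card generalizing C with
  | zero =>
    refine ⟨2, fun V c _ hC hV => ?_⟩
    obtain ⟨x, hx, y, hy, hxy⟩ := Finset.one_lt_card.1 hV
    have := hC x hx y hy hxy
    rw [Finset.card_eq_zero.1 hn] at this
    simp at this
  | succ n ih =>
    have h1 : ∀ k ∈ C, ∃ R : ℕ, ∀ (V : Finset ℕ) (c : ℕ → ℕ → ℕ),
        (∀ x y, c x y = c y x) → (∀ x ∈ V, ∀ y ∈ V, x ≠ y → c x y ∈ C.erase k) → R ≤ V.card →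
        ∃ x ∈ V, ∃ y ∈ V, ∃ z ∈ V, x ≠ y ∧ x ≠ z ∧ y ≠ z ∧ c x y = c x z ∧ c x y = c y z :=
      fun k hk => ih (C.erase k) (by rw [Finset.card_erase_of_mem hk, hn]; rfl)
    choose! f hf using h1
    set R := C.sup f with hR
    refine ⟨C.card * R + 2, fun V c hs hC hV => ?_⟩
    obtain ⟨v, hv⟩ : V.Nonempty := Finset.card_pos.1 (by omega)
    have hmap : ∀ x ∈ V.erase v, c v x ∈ C := fun x hx =>
      hC v hv x (Finset.mem_of_mem_erase hx) (Finset.ne_of_mem_erase hx).symm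
    obtain ⟨k, hk, hkR⟩ := Finset.exists_lt_card_fiber_of_mul_lt_card_of_maps_to hmap
      (n := R) (by rw [Finset.card_erase_of_mem hv]; omega)
    by_cases hE : ∃ x ∈ (V.erase v).filter (fun x => c v x = k),
        ∃ y ∈ (V.erase v).filter (fun x => c v x = k), x ≠ y ∧ c x y = k
    · obtain ⟨x, hx, y, hy, hxy, hc⟩ := hE
      simp only [Finset.mem_filter, Finset.mem_erase] at hx hy
      exact ⟨v, hv, x, hx.1.2, y, hy.1.2, hx.1.1.symm, hy.1.1.symm, hxy, by rw [hx.2, hy.2],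
        by rw [hx.2, hc]⟩
    · push Not at hE
      obtain ⟨x, hx, y, hy, z, hz, h⟩ := hf k hk ((V.erase v).filter (fun x => c v x = k)) c hs
        (fun x hx y hy hxy => Finset.mem_erase.2 ⟨hE x hx y hy hxy, hC x
          (Finset.mem_of_mem_erase (Finset.mem_filter.1 hx).1) y
          (Finset.mem_of_mem_erase (Finset.mem_filter.1 hy).1) hxy⟩)
        ((Finset.le_sup hk).trans hkR.le)
      exact ⟨x, Finset.mem_of_mem_erase (Finset.mem_filter.1 hx).1, y,
        Finset.mem_of_mem_erase (Finset.mem_filter.1 hy).1, z,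
        Finset.mem_of_mem_erase (Finset.mem_filter.1 hz).1, h⟩

/-- The set whose infimum defines `ramsey k 3` is nonempty. -/
theorem ramsey_set_nonempty (k : ℕ) :
    {R : ℕ | ∀ c : {e : Sym2 (Fin R) // ¬ e.IsDiag} → Fin k,
      ∃ s : Finset (Fin R), 3 ≤ s.card ∧
        ∀ e e', (∀ i ∈ e.1, i ∈ s) → (∀ i ∈ e'.1, i ∈ s) → c e = c e'}.Nonempty := by
  obtain ⟨R, hR⟩ := exists_mono_triangle (Finset.range k)
  refine ⟨R, fun c => ?_⟩
  let col : ℕ → ℕ → ℕ := fun a b =>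
    if h : ∃ (ha : a < R) (hb : b < R), a ≠ b then
      (c ⟨s(⟨a, h.1⟩, ⟨b, h.2.1⟩), by simpa using h.2.2⟩ : ℕ)
    else 0
  have hcol : ∀ (a b : Fin R) (h : a ≠ b),
      col a b = (c ⟨s(a, b), by simpa using h⟩ : ℕ) := by
    intro a b h
    have : ∃ (ha : (a : ℕ) < R) (hb : (b : ℕ) < R), (a : ℕ) ≠ b :=
      ⟨a.2, b.2, fun h' => h (Fin.ext h')⟩
    simp only [col, dif_pos this]
  obtain ⟨x, hx, y, hy, z, hz, hxy, hxz, hyz, h1, h2⟩ := hR (Finset.range R) col (by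
      intro x y
      simp only [col]
      by_cases h : ∃ (ha : x < R) (hb : y < R), x ≠ y
      · have h' : ∃ (ha : y < R) (hb : x < R), y ≠ x := ⟨h.2.1, h.1, h.2.2.symm⟩
        rw [dif_pos h, dif_pos h']
        congr 3
        exact Sym2.eq_swap
      · have h' : ¬ ∃ (ha : y < R) (hb : x < R), y ≠ x := fun h' =>
          h ⟨h'.2.1, h'.1, h'.2.2.symm⟩
        rw [dif_neg h, dif_neg h'])
    (by
      intro x hx y hy hxy
      have := hcol ⟨x, Finset.mem_range.1 hx⟩ ⟨y, Finset.mem_range.1 hy⟩ (by simpa using hxy)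
      simp only at this
      rw [this]
      exact Finset.mem_range.2 (Fin.is_lt _))
    (by simp)
  rw [Finset.mem_range] at hx hy hz
  set X : Fin R := ⟨x, hx⟩
  set Y : Fin R := ⟨y, hy⟩
  set Z : Fin R := ⟨z, hz⟩
  have hXY : X ≠ Y := by simpa [X, Y] using hxy
  have hXZ : X ≠ Z := by simpa [X, Z] using hxz
  have hYZ : Y ≠ Z := by simpa [Y, Z] using hyz
  have e1 := hcol X Y hXY
  have e2 := hcol X Z hXZ
  have e3 := hcol Y Z hYZ
  have key : ∀ e : {e : Sym2 (Fin R) // ¬ e.IsDiag}, (∀ i ∈ e.1, i ∈ ({X, Y, Z} : Finset (Fin R))) →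
      (c e : ℕ) = col x y := by
    rintro ⟨e, he⟩ hi
    induction e with
    | _ a b =>
      have ha := hi a (by simp)
      have hb := hi b (by simp)
      have hab : a ≠ b := by simpa using he
      have hsw : (c ⟨s(a, b), he⟩ : ℕ) = c ⟨s(b, a), by simpa using hab.symm⟩ := by
        congr 3
        exact Sym2.eq_swap
      simp only [Finset.mem_insert, Finset.mem_singleton] at ha hb
      rcases ha with rfl | rfl | rfl <;> rcases hb with rfl | rfl | rfl <;>
        first
        | exact absurd rfl hab
        | exact e1.symm
        | exact e2.symm.trans h1.symm
        | exact e3.symm.trans h2.symm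
        | exact hsw.trans e1.symm
        | exact hsw.trans (e2.symm.trans h1.symm)
        | exact hsw.trans (e3.symm.trans h2.symm)
  refine ⟨{X, Y, Z}, by rw [Finset.card_eq_three.2 ⟨X, Y, Z, hXY, hXZ, hYZ, rfl⟩], ?_⟩
  intro e e' he he'
  exact Fin.ext ((key e he).trans (key e' he').symm)

theorem ramsey_mono {k l : ℕ} (h : k ≤ l) : ramsey k 3 ≤ ramsey l 3 := by
  refine Nat.sInf_le fun c => ?_
  obtain ⟨s, hs, hc⟩ := Nat.sInf_mem (ramsey_set_nonempty l) fun e => Fin.castLE h (c e)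
  exact ⟨s, hs, fun e e' he he' => Fin.castLE_injective h (hc e e' he he')⟩

theorem lenB_succ (P : BoundParams) (d i : ℕ) : lenB P (d + 1) i =
    if P.N < i then P.b
    else 32 * P.M ^ 2 * lenB P d 1 * lenB P (d + 1) (i + 1) *
      (ramsey (typesB P (d + 1) i) 3 + 2) ^ (2 * ampB P (d + 1) i + 1) := by
  conv_lhs => rw [lenB]

theorem coverB_succ (P : BoundParams) (d i : ℕ) : coverB P (d + 1) i =
    if P.N ≤ i then 1
    else 8 * P.M ^ 2 *
      (maxWtB P d * lenB P d 1 * lenB P (d + 1) (i + 1) + coverB P (d + 1) (i + 1) + P.h) := by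
  conv_lhs => rw [coverB]

theorem ampB_succ (P : BoundParams) (d i : ℕ) : ampB P (d + 1) i =
    if P.N < i then 0
    else 32 * P.M ^ 2 * (P.h + 2 * maxWtB P d) *
      (ramsey (typesB P (d + 1) i) 3 + lenB P (d + 1) (i + 1) + lenB P d 1) := by
  conv_lhs => rw [ampB]

/-- The length bounds grow with the additive constant `h`, and replacing the index `1` by `0` in
the recursion for the maximal weight only increases them. -/
theorem lenB_le_lenB {P P' : BoundParams} (hN : P.N = P'.N) (hN0 : 1 ≤ P.N) (hW : P.W₀ = P'.W₀)
    (hb : P.b = P'.b) (hh : P.h ≤ P'.h) (hm : P.m = 1) (hm' : P'.m = 0) (d : ℕ) :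
    (∀ i, lenB P d i ≤ lenB P' d i) ∧ maxWtB P d ≤ maxWtB P' d := by
  have hM : P.M = P'.M := by simp [BoundParams.M, hN]
  have hM1 : 1 ≤ P'.M := by
    rw [← hM]
    exact Nat.mul_pos hN0 (Nat.factorial_pos _)
  induction d with
  | zero =>
    refine ⟨fun i => by simp [lenB], ?_⟩
    rw [maxWtB, maxWtB, hW]
  | succ d ih =>
    obtain ⟨ihL, ihW⟩ := ih
    -- The values at `i` depend on those at `i + 1`, up to `i = N + 1`, where the length is `b`.
    have inner : ∀ k i, P.N + 1 ≤ i + k →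
        lenB P (d + 1) i ≤ lenB P' (d + 1) i ∧ coverB P (d + 1) i ≤ coverB P' (d + 1) i := by
      intro k
      induction k with
      | zero =>
        intro i hi
        rw [lenB_succ P, lenB_succ P', coverB_succ P, coverB_succ P', if_pos (by omega),
          if_pos (by omega), if_pos (by omega), if_pos (by omega)]
        exact ⟨hb.le, le_rfl⟩
      | succ k ihk =>
        intro i hi
        obtain ⟨h1, h2⟩ := ihk (i + 1) (by omega)
        have hcov : coverB P (d + 1) i ≤ coverB P' (d + 1) i := by
          rw [coverB_succ P, coverB_succ P', ← hN]
          split_ifs with hi'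
          · exact le_rfl
          · rw [hM]
            have := ihL 1
            gcongr
        refine ⟨?_, hcov⟩
        by_cases hi' : P.N < i
        · rw [lenB_succ P, lenB_succ P', if_pos hi', if_pos (hN ▸ hi')]
          exact hb.le
        have htyp : typesB P (d + 1) i ≤ typesB P' (d + 1) i := by
          rw [typesB, typesB, hN]
          gcongr
        have hram := ramsey_mono htyp
        have hamp : ampB P (d + 1) i ≤ ampB P' (d + 1) i := by
          rw [ampB_succ P, ampB_succ P', if_neg hi', if_neg (hN ▸ hi'), hM]
          have := ihL 1
          gcongr
        rw [lenB_succ P, lenB_succ P', if_neg hi', if_neg (hN ▸ hi'), hM]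
        have := ihL 1
        gcongr
        omega
    have hL : ∀ i, lenB P (d + 1) i ≤ lenB P' (d + 1) i :=
      fun i => (inner (P.N + 1) i (by omega)).1
    refine ⟨hL, ?_⟩
    rw [maxWtB, maxWtB, hm, hm', hM]
    -- If the first factor `lenB P' d 1` of `lenB P' (d + 1) 0` vanishes, so does `lenB P' (d + 1) 1`.
    have h01 : lenB P' (d + 1) 1 ≤ lenB P' (d + 1) 0 := by
      rw [lenB_succ P' d 0]
      simp only [Nat.not_lt_zero, if_false, Nat.zero_add]
      rcases Nat.eq_zero_or_pos (lenB P' d 1) with h0 | h0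
      · rw [lenB_succ, if_neg (by omega), h0]
        simp
      · have : 0 < 32 * P'.M ^ 2 * lenB P' d 1 := by positivity
        have h3 : 1 ≤ (ramsey (typesB P' (d + 1) 0) 3 + 2) ^ (2 * ampB P' (d + 1) 0 + 1) :=
          Nat.one_le_pow _ _ (by omega)
        calc lenB P' (d + 1) 1 = 1 * lenB P' (d + 1) 1 * 1 := by ring
          _ ≤ _ := by gcongr; exact this
    have := (hL 1).trans h01
    gcongr

section

variable {Q Λ : Type*} [Fintype Q] [DecidableEq Q]

theorem numStates_pos (A : WFA Q Λ) : 1 ≤ numStates Q :=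
  Fintype.card_pos_iff.2 ⟨A.start⟩

theorem bigM_pos (A : WFA Q Λ) : 1 ≤ bigM Q :=
  Nat.mul_pos (numStates_pos A) (Nat.factorial_pos _)

theorem numStates_le_bigM : numStates Q ≤ bigM Q :=
  Nat.le_mul_of_pos_right _ (Nat.factorial_pos _)

variable [Fintype Λ]

theorem simpL_le_genL (A : WFA Q Λ) (b d : ℕ) : simpL A b d ≤ genL A b d :=
  (lenB_le_lenB (P := simpParams A b) (P' := genParams A b) rfl (numStates_pos A) rfl rfl
    (Nat.zero_le _) rfl rfl d).1 1

end

/-! ### Powers of weight matrices -/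

section

variable {Q Λ : Type*} [Fintype Q] [DecidableEq Q]

theorem WtMat.mul_le (m m' : WtMat Q) (s r t : State Q) : WtMat.mul m m' s t ≤ m s r + m' r t :=
  Finset.inf_le (f := fun r => m s r + m' r t) (Finset.mem_univ r)

theorem WtMat.exists_mul_eq (m m' : WtMat Q) (s t : State Q) :
    ∃ r, WtMat.mul m m' s t = m s r + m' r t := by
  obtain ⟨r, -, hr⟩ := Finset.exists_mem_eq_inf (Finset.univ : Finset (State Q)) ⟨s, by simp⟩
    (fun r => m s r + m' r t)
  exact ⟨r, hr⟩

theorem WtMat.mul_ne_top {m m' : WtMat Q} {s t : State Q} :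
    WtMat.mul m m' s t ≠ ⊤ ↔ ∃ r, m s r ≠ ⊤ ∧ m' r t ≠ ⊤ := by
  constructor
  · intro h
    obtain ⟨r, hr⟩ := WtMat.exists_mul_eq m m' s t
    rw [hr] at h
    exact ⟨r, WithTop.add_ne_top.1 h⟩
  · rintro ⟨r, h⟩
    exact ne_top_of_le_ne_top (WithTop.add_ne_top.2 h) (WtMat.mul_le m m' s r t)

theorem WtMat.mul_one (m : WtMat Q) : WtMat.mul m WtMat.one = m := by
  funext s t
  refine le_antisymm ((WtMat.mul_le _ _ s t t).trans (by simp [WtMat.one])) ?_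
  refine Finset.le_inf fun r _ => ?_
  by_cases h : r = t
  · subst h; simp [WtMat.one]
  · simp [WtMat.one, h]

theorem WtMat.pow_zero (m : WtMat Q) : WtMat.pow m 0 = WtMat.one := rfl

theorem WtMat.pow_succ (m : WtMat Q) (n : ℕ) :
    WtMat.pow m (n + 1) = WtMat.mul m (WtMat.pow m n) := rfl

theorem WtMat.pow_one (m : WtMat Q) : WtMat.pow m 1 = m := WtMat.mul_one m

theorem WtMat.pow_add (m : WtMat Q) (a b : ℕ) :
    WtMat.pow m (a + b) = WtMat.mul (WtMat.pow m a) (WtMat.pow m b) := by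
  induction a with
  | zero => rw [Nat.zero_add, WtMat.pow_zero, WtMat.one_mul]
  | succ a ih => rw [Nat.succ_add, WtMat.pow_succ, ih, WtMat.pow_succ, WtMat.mul_assoc]

theorem WtMat.pow_mul (m : WtMat Q) (a b : ℕ) :
    WtMat.pow m (a * b) = WtMat.pow (WtMat.pow m a) b := by
  induction b with
  | zero => rfl
  | succ b ih => rw [Nat.mul_succ, Nat.add_comm, WtMat.pow_add, ih, WtMat.pow_succ]

theorem WtMat.pow_add_le (m : WtMat Q) (a b : ℕ) (s r t : State Q) :
    WtMat.pow m (a + b) s t ≤ WtMat.pow m a s r + WtMat.pow m b r t := by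
  rw [WtMat.pow_add]
  exact WtMat.mul_le _ _ s r t

theorem WtMat.pow_add_ne_top {m : WtMat Q} {a b : ℕ} {s r t : State Q}
    (h₁ : WtMat.pow m a s r ≠ ⊤) (h₂ : WtMat.pow m b r t ≠ ⊤) : WtMat.pow m (a + b) s t ≠ ⊤ :=
  ne_top_of_le_ne_top (WithTop.add_ne_top.2 ⟨h₁, h₂⟩) (WtMat.pow_add_le m a b s r t)

theorem WtMat.pow_self_le (m : WtMat Q) (n : ℕ) (s : State Q) (c : ℤ)
    (h : m s s ≤ (c : WithTop ℤ)) : WtMat.pow m n s s ≤ ((n * c : ℤ) : WithTop ℤ) := by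
  induction n with
  | zero => simp [WtMat.pow_zero, WtMat.one]
  | succ n ih =>
    refine (WtMat.mul_le _ _ s s s).trans ((add_le_add h ih).trans (le_of_eq ?_))
    rw [← WithTop.coe_add]
    congr 1
    push_cast
    ring

theorem WtMat.pow_self_ne_top {m : WtMat Q} {s : State Q} (h : m s s ≠ ⊤) (n : ℕ) :
    WtMat.pow m n s s ≠ ⊤ := by
  obtain ⟨c, hc⟩ := WithTop.ne_top_iff_exists.1 h
  exact ne_top_of_le_ne_top WithTop.coe_ne_top (WtMat.pow_self_le m n s c hc.symm.le)

theorem WtMat.exists_path (m : WtMat Q) (n : ℕ) (s t : State Q) (h : WtMat.pow m n s t ≠ ⊤) :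
    ∃ f : ℕ → State Q, f 0 = s ∧ f n = t ∧
      WtMat.pow m n s t = ∑ i ∈ Finset.range n, m (f i) (f (i + 1)) := by
  induction n generalizing s with
  | zero =>
    have hst : s = t := by
      by_contra hst
      simp [WtMat.pow_zero, WtMat.one, hst] at h
    exact ⟨fun _ => s, rfl, hst, by simp [WtMat.pow_zero, WtMat.one, hst]⟩
  | succ n ih =>
    obtain ⟨r, hr⟩ := WtMat.exists_mul_eq m (WtMat.pow m n) s t
    rw [WtMat.pow_succ, hr] at h
    obtain ⟨f, hf0, hfn, hf⟩ := ih r (WithTop.add_ne_top.1 h).2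
    refine ⟨fun i => if i = 0 then s else f (i - 1), by simp, by simp [hfn], ?_⟩
    rw [WtMat.pow_succ, hr, Finset.sum_range_succ', hf, add_comm]
    simp [hf0]

theorem WtMat.pow_le_sum (m : WtMat Q) (f : ℕ → State Q) (k : ℕ) :
    WtMat.pow m k (f 0) (f k) ≤ ∑ i ∈ Finset.range k, m (f i) (f (i + 1)) := by
  induction k with
  | zero => simp [WtMat.pow_zero, WtMat.one]
  | succ k ih =>
    rw [Finset.sum_range_succ]
    refine (WtMat.pow_add_le m k 1 _ (f k) _).trans (add_le_add ih ?_)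
    rw [WtMat.pow_one]

/-- By the pigeonhole principle a run of length at least the number of states contains a cycle
that starts and ends within its first `numStates Q` steps. -/
theorem WtMat.exists_cycle (m : WtMat Q) {n : ℕ} (hn : numStates Q ≤ n) {s t : State Q}
    (h : WtMat.pow m n s t ≠ ⊤) : ∃ a b c g, a + b + c = n ∧ 1 ≤ b ∧ a + b ≤ numStates Q ∧
      WtMat.pow m a s g + WtMat.pow m b g g + WtMat.pow m c g t ≤ WtMat.pow m n s t := by
  obtain ⟨f, rfl, rfl, hf⟩ := WtMat.exists_path m n s t h
  obtain ⟨i, j, hij, hfij⟩ : ∃ i j : Fin (numStates Q + 1), i < j ∧ f i = f j := by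
    obtain ⟨i, j, hne, h⟩ := Fintype.exists_ne_map_eq_of_card_lt
      (fun i : Fin (numStates Q + 1) => f i) (by
        rw [Fintype.card_fin]; exact Nat.lt_succ_self _)
    rcases lt_or_gt_of_ne hne with h' | h'
    · exact ⟨i, j, h', h⟩
    · exact ⟨j, i, h', h.symm⟩
  obtain ⟨b, hb⟩ := Nat.exists_eq_add_of_lt (Fin.lt_def.1 hij)
  have hj := j.2
  obtain ⟨c, hc⟩ := Nat.exists_eq_add_of_le (show (j : ℕ) ≤ n by omega)
  refine ⟨i, b + 1, c, f i, by omega, by omega, by omega, ?_⟩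
  have e : n = i + ((b + 1) + c) := by omega
  have h1 := WtMat.pow_le_sum m f i
  have h2 := WtMat.pow_le_sum m (fun k => f (i + k)) (b + 1)
  have h3 := WtMat.pow_le_sum m (fun k => f (i + (b + 1 + k))) c
  have e1 : f (i + (b + 1)) = f i := by rw [hfij, hb, add_assoc]
  have e2 : f (i + (b + 1 + c)) = f n := by rw [← e]
  simp only [add_zero, e1, e2] at h2 h3
  rw [hf]
  conv_rhs => rw [e, Finset.sum_range_add, Finset.sum_range_add, ← add_assoc]
  exact add_le_add (add_le_add h1 h2) h3

/-- If `g` has a self-loop and is reachable from `s`, then it is reachable in every number of steps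
that is at least the number of states: shorten the run and wait at `g`. -/
theorem WtMat.pow_ge_of_loop {m : WtMat Q} {s g : State Q} (hg : m g g ≠ ⊤) {k : ℕ}
    (h : WtMat.pow m k s g ≠ ⊤) : ∀ n, numStates Q ≤ n → WtMat.pow m n s g ≠ ⊤ := by
  induction k using Nat.strong_induction_on with
  | _ k ih =>
    intro n hn
    rcases le_or_gt k n with hk | hk
    · obtain ⟨d, rfl⟩ := Nat.exists_eq_add_of_le hk
      exact WtMat.pow_add_ne_top h (WtMat.pow_self_ne_top hg d)
    · obtain ⟨a, b, c, r, habc, hb, -, hle⟩ := WtMat.exists_cycle m (hn.trans hk.le) h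
      have h' := ne_top_of_le_ne_top h hle
      rw [WithTop.add_ne_top, WithTop.add_ne_top] at h'
      exact ih (a + c) (by omega) (WtMat.pow_add_ne_top h'.1.1 h'.2) n hn

/-- A state on a cycle lies on a cycle of length at most `numStates Q`. -/
theorem WtMat.exists_short_loop {m : WtMat Q} {g : State Q} {n : ℕ} (hn : 1 ≤ n)
    (h : WtMat.pow m n g g ≠ ⊤) : ∃ l, 1 ≤ l ∧ l ≤ numStates Q ∧ WtMat.pow m l g g ≠ ⊤ := by
  induction n using Nat.strong_induction_on with
  | _ n ih =>
    rcases le_or_gt n (numStates Q) with hk | hk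
    · exact ⟨n, hn, hk, h⟩
    · obtain ⟨a, b, c, r, habc, hb, hab, hle⟩ := WtMat.exists_cycle m hk.le h
      have h' := ne_top_of_le_ne_top h hle
      rw [WithTop.add_ne_top, WithTop.add_ne_top] at h'
      exact ih (a + c) (by omega) (by omega) (WtMat.pow_add_ne_top h'.1.1 h'.2)

/-- If `g` lies on a cycle and can be reached from `s` in a number of steps divisible by
`𝔪 = |S| · |S|!`, then it can be reached in exactly `𝔪` steps: take a cycle of length `l ≤ |S|` at
`g`, shorten the run to at most `|S|` blocks of `l` steps, and fill up with copies of the cycle. -/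
theorem WtMat.pow_bigM_of_loop {m : WtMat Q} {s g : State Q} {n k : ℕ} (hn : 1 ≤ n)
    (hg : WtMat.pow m n g g ≠ ⊤) (h : WtMat.pow m (bigM Q * k) s g ≠ ⊤) :
    WtMat.pow m (bigM Q) s g ≠ ⊤ := by
  obtain ⟨l, hl1, hlN, hl⟩ := WtMat.exists_short_loop hn hg
  obtain ⟨d, hd⟩ := Nat.dvd_factorial hl1 hlN
  have hM : bigM Q = l * (numStates Q * d) := by rw [bigM, hd]; ring
  have hd1 : 1 ≤ d := by
    rcases Nat.eq_zero_or_pos d with h0 | h0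
    · exact absurd (h0 ▸ hd) (by simpa using Nat.factorial_ne_zero _)
    · exact h0
  rw [hM, _root_.mul_assoc, WtMat.pow_mul] at h
  rw [hM, WtMat.pow_mul]
  exact WtMat.pow_ge_of_loop hl h _ (Nat.le_mul_of_pos_right _ hd1)

/-- Pumping: a run of `𝔪 k` steps, `k ≥ 1`, contains a cycle whose length divides `𝔪`. -/
theorem WtMat.pow_bigM_pump {m : WtMat Q} {s t : State Q} {k : ℕ} (hk : 1 ≤ k) (j : ℕ)
    (h : WtMat.pow m (bigM Q * k) s t ≠ ⊤) : WtMat.pow m (bigM Q * (k + j)) s t ≠ ⊤ := by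
  obtain ⟨a, b, c, g, habc, hb, hab, hle⟩ := WtMat.exists_cycle m
    (numStates_le_bigM.trans (Nat.le_mul_of_pos_right _ hk)) h
  have h' := ne_top_of_le_ne_top h hle
  rw [WithTop.add_ne_top, WithTop.add_ne_top] at h'
  obtain ⟨⟨h1, h2⟩, h3⟩ := h'
  obtain ⟨d, hd⟩ := Nat.dvd_factorial hb (show b ≤ numStates Q by omega)
  have e : bigM Q * (k + j) = a + b * (1 + numStates Q * d * j) + c := by
    rw [mul_add, ← habc, bigM, hd]; ring
  rw [e]
  refine WtMat.pow_add_ne_top (WtMat.pow_add_ne_top h1 ?_) h3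
  rw [WtMat.pow_mul]
  exact WtMat.pow_self_ne_top h2 _

theorem WtMat.mem_of_pow_ne_top {m : WtMat Q} {S' : Set (State Q)}
    (hS : ∀ s ∈ S', ∀ t, m s t ≠ ⊤ → t ∈ S') (n : ℕ) {s t : State Q} (hs : s ∈ S')
    (hn : WtMat.pow m n s t ≠ ⊤) : t ∈ S' := by
  induction n generalizing s with
  | zero =>
    by_contra ht
    have : s ≠ t := fun e => ht (e ▸ hs)
    simp [WtMat.pow_zero, WtMat.one, this] at hn
  | succ n ih =>
    obtain ⟨r, h1, h2⟩ := WtMat.mul_ne_top.1 hn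
    exact ih (hS s hs r h1) h2

/-- A lower bound on the slopes of the cycles of length at most `numStates Q` within `S'` is a
lower bound on the slopes of all cycles: a longer cycle splits into two shorter ones. -/
theorem WtMat.slope_le_of_short {m : WtMat Q} {S' : Set (State Q)}
    (hS : ∀ s ∈ S', ∀ t, m s t ≠ ⊤ → t ∈ S') {c : ℤ} {n₀ : ℕ}
    (hshort : ∀ r ∈ S', ∀ n : ℕ, 1 ≤ n → n ≤ numStates Q → ∀ w : ℤ,
      WtMat.pow m n r r = w → c * n ≤ n₀ * w) :
    ∀ (n : ℕ), ∀ r ∈ S', ∀ w : ℤ, WtMat.pow m n r r = w → c * n ≤ n₀ * w := by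
  intro n
  induction n using Nat.strong_induction_on with
  | _ n ih =>
    intro r hr w hw
    rcases Nat.eq_zero_or_pos n with rfl | hn0
    · have : w = 0 := by
        rw [WtMat.pow_zero, WtMat.one, if_pos rfl] at hw
        exact_mod_cast hw.symm
      simp [this]
    rcases le_or_gt n (numStates Q) with hk | hk
    · exact hshort r hr n hn0 hk w hw
    · have hne : WtMat.pow m n r r ≠ ⊤ := by rw [hw]; exact WithTop.coe_ne_top
      obtain ⟨a, b, d, g, habc, hb, hab, hle⟩ := WtMat.exists_cycle m hk.le hne
      have h' := ne_top_of_le_ne_top hne hle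
      rw [WithTop.add_ne_top, WithTop.add_ne_top] at h'
      obtain ⟨⟨h1, h2⟩, h3⟩ := h'
      have hg := WtMat.mem_of_pow_ne_top hS a hr h1
      obtain ⟨w1, hw1⟩ := WithTop.ne_top_iff_exists.1 h1
      obtain ⟨w2, hw2⟩ := WithTop.ne_top_iff_exists.1 h2
      obtain ⟨w3, hw3⟩ := WithTop.ne_top_iff_exists.1 h3
      obtain ⟨w4, hw4⟩ := WithTop.ne_top_iff_exists.1 (WtMat.pow_add_ne_top h1 h3)
      have hle' := WtMat.pow_add_le m a d r g r
      rw [← hw4, ← hw1, ← hw3] at hle'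
      rw [← hw1, ← hw2, ← hw3, hw] at hle
      norm_cast at hle hle'
      have i1 := ih b (by omega) g hg w2 hw2.symm
      have i2 := ih (a + d) (by omega) r hr w4 hw4.symm
      have hn : (n : ℤ) = b + (a + d : ℕ) := by omega
      have hw' : (n₀ : ℤ) * (w2 + w4) ≤ n₀ * w :=
        mul_le_mul_of_nonneg_left (by linarith) (Int.natCast_nonneg n₀)
      rw [hn]
      linarith

/-- If some cycle has negative weight, then there is a cycle of minimal slope (weight per step), and
by the pigeonhole principle one of at most `numStates Q` steps. -/
theorem WtMat.exists_min_slope {m : WtMat Q} {S' : Set (State Q)}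
    (hS : ∀ s ∈ S', ∀ t, m s t ≠ ⊤ → t ∈ S')
    (hneg : ∃ n, ∃ r ∈ S', ∃ w : ℤ, WtMat.pow m n r r = w ∧ w < 0) :
    ∃ r ∈ S', ∃ n₀ : ℕ, 1 ≤ n₀ ∧ n₀ ≤ numStates Q ∧ ∃ c : ℤ, WtMat.pow m n₀ r r = c ∧ c < 0 ∧
      ∀ (n : ℕ), ∀ s ∈ S', ∀ w : ℤ, WtMat.pow m n s s = w → c * n ≤ n₀ * w := by
  classical
  obtain ⟨r₁, hr₁, n₁, h1, h1N, w₁, hw₁, hneg₁⟩ : ∃ r ∈ S', ∃ n : ℕ, 1 ≤ n ∧ n ≤ numStates Q ∧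
      ∃ w : ℤ, WtMat.pow m n r r = w ∧ w < 0 := by
    by_contra hno
    push Not at hno
    obtain ⟨n, r, hr, w, hw, hlt⟩ := hneg
    have := WtMat.slope_le_of_short (c := 0) (n₀ := 1) hS (fun r hr n h1 h2 w hw => by
      simpa using hno r hr n h1 h2 w hw) n r hr w hw
    simp at this
    omega
  let F : Finset (State Q × ℕ) := (Finset.univ ×ˢ Finset.Icc 1 (numStates Q)).filter
    fun p => p.1 ∈ S' ∧ WtMat.pow m p.2 p.1 p.1 ≠ ⊤
  have hF : ∀ r n, (r, n) ∈ F ↔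
      (1 ≤ n ∧ n ≤ numStates Q) ∧ r ∈ S' ∧ WtMat.pow m n r r ≠ ⊤ := by
    intro r n
    simp [F]
  obtain ⟨⟨r, n₀⟩, hmem, hmin⟩ := Finset.exists_min_image F
    (fun p => (((WtMat.pow m p.2 p.1 p.1).untopD 0 : ℤ) : ℚ) / p.2)
    ⟨(r₁, n₁), (hF _ _).2 ⟨⟨h1, h1N⟩, hr₁, by rw [hw₁]; exact WithTop.coe_ne_top⟩⟩
  obtain ⟨⟨hn1, hnN⟩, hr, hne⟩ := (hF _ _).1 hmem
  obtain ⟨c, hc⟩ := WithTop.ne_top_iff_exists.1 hne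
  have hshort : ∀ s ∈ S', ∀ n : ℕ, 1 ≤ n → n ≤ numStates Q → ∀ w : ℤ,
      WtMat.pow m n s s = w → c * n ≤ n₀ * w := by
    intro s hs n h1 h2 w hw
    have := hmin (s, n) ((hF _ _).2 ⟨⟨h1, h2⟩, hs, by rw [hw]; exact WithTop.coe_ne_top⟩)
    simp only [hw, ← hc, WithTop.untopD_coe] at this
    rw [div_le_div_iff₀ (by exact_mod_cast hn1) (by exact_mod_cast h1)] at this
    have h' : c * n ≤ w * n₀ := by exact_mod_cast this
    linarith
  refine ⟨r, hr, n₀, hn1, hnN, c, hc.symm, ?_, WtMat.slope_le_of_short hS hshort⟩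
  have h2 := hshort r₁ hr₁ n₁ h1 h1N w₁ hw₁
  by_contra hc0
  have h3 : 0 ≤ c * n₁ := mul_nonneg (not_lt.1 hc0) (by positivity)
  have h4 : (n₀ : ℤ) * w₁ < 0 := mul_neg_of_pos_of_neg (by exact_mod_cast hn1) hneg₁
  linarith

end

/-! ### Readability of words and the last two components of states -/

section

variable {Q Λ : Type*}

/-- The last two components (baseline component and reachable set) of a state. -/
def State.tag (s : State Q) : Q × Finset Q := s.1.2

theorem mem_fiber_iff {q : Q} {T : Finset Q} {s : State Q} : s ∈ fiber q T ↔ s.tag = (q, T) := by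
  rw [Prod.ext_iff]
  exact Iff.rfl

theorem State.ext' {s t : State Q} (h : s.inner = t.inner) (h' : s.tag = t.tag) : s = t :=
  Subtype.ext (Prod.ext h h')

theorem State.eq_of_isBaseline {s t : State Q} (hs : s.IsBaseline) (ht : t.IsBaseline)
    (h : s.tag = t.tag) : s = t := by
  refine State.ext' ?_ h
  rw [hs, ht]
  exact congrArg Prod.fst h

theorem wpow_zero {α : Type*} (w : List α) : wpow w 0 = [] := rfl

theorem wpow_succ {α : Type*} (w : List α) (n : ℕ) : wpow w (n + 1) = w ++ wpow w n := by
  simp [wpow, List.replicate_succ]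

theorem mem_of_mem_wpow {α : Type*} {w : List α} {n : ℕ} {a : α} (h : a ∈ wpow w n) : a ∈ w := by
  rw [wpow, List.mem_flatten] at h
  obtain ⟨l, hl, ha⟩ := h
  rwa [List.eq_of_mem_replicate hl] at ha

theorem length_wpow {α : Type*} (w : List α) (n : ℕ) : (wpow w n).length = n * w.length := by
  simp [wpow]

theorem depth_le_wordDepth {w : Word Q Λ} {a : Letter Q Λ} (h : a ∈ w) :
    a.depth ≤ wordDepth w := by
  induction w with
  | nil => simp at h
  | cons c w ih =>
    rw [wordDepth]
    rcases List.mem_cons.1 h with rfl | h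
    · exact le_max_left _ _
    · exact (ih h).trans (le_max_right _ _)

theorem wordDepth_append (w w' : Word Q Λ) :
    wordDepth (w ++ w') = max (wordDepth w) (wordDepth w') := by
  induction w with
  | nil => simp [wordDepth]
  | cons a w ih => rw [List.cons_append, wordDepth, ih, wordDepth, max_assoc]

theorem wordDepth_wpow (w : Word Q Λ) {n : ℕ} (hn : 1 ≤ n) : wordDepth (wpow w n) = wordDepth w := by
  induction n, hn using Nat.le_induction with
  | base => rw [wpow_succ, wpow_zero, List.append_nil]
  | succ n _ ih => rw [wpow_succ, wordDepth_append, ih, max_self]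

theorem start_tag_reach (A : WFA Q Λ) {s : State Q} (h : s.tag = A.start.tag) : s = A.start := by
  refine State.ext' ?_ h
  have h2 : s.reach = {A.init} := congrArg Prod.snd h
  have h3 : s.inner ∈ s.reach := s.2.1
  rw [h2, Finset.mem_singleton] at h3
  exact h3

/-- The tag of the source of a transition determines the tag of its target. -/
def WtMat.TagDet (m : WtMat Q) : Prop :=
  ∀ s s' t t' : State Q, s.tag = s'.tag → m s t ≠ ⊤ → m s' t' ≠ ⊤ → t.tag = t'.tag

variable [DecidableEq Q]

theorem jumpMat_ne_top {T : Finset Q} {p₁ p₂ : Q} {s t : State Q} :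
    jumpMat T p₁ p₂ s t ≠ ⊤ ↔ s.tag = (p₁, T) ∧ t.tag = (p₂, T) ∧ s.inner = t.inner := by
  rw [Prod.ext_iff, Prod.ext_iff]
  change _ ↔ (s.base = p₁ ∧ s.reach = T) ∧ (t.base = p₂ ∧ t.reach = T) ∧ _
  unfold jumpMat
  split_ifs with h
  · simp only [ne_eq, WithTop.zero_ne_top, not_false_eq_true, true_iff]
    tauto
  · simp only [ne_eq, not_true_eq_false, false_iff]
    tauto

theorem WtMat.tagDet_one : (WtMat.one : WtMat Q).TagDet := by
  intro s s' t t' h h1 h2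
  have e1 : s = t := by
    by_contra hne
    simp [WtMat.one, hne] at h1
  have e2 : s' = t' := by
    by_contra hne
    simp [WtMat.one, hne] at h2
  rw [← e1, ← e2, h]

variable [Fintype Q]

theorem mwt_append_ne_top (A : WFA Q Λ) {w w' : Word Q Λ} {s t : State Q} :
    mwt A (w ++ w') s t ≠ ⊤ ↔ ∃ r, mwt A w s r ≠ ⊤ ∧ mwt A w' r t ≠ ⊤ := by
  rw [mwt_append, WtMat.mul_ne_top]

theorem mwt_singleton (A : WFA Q Λ) (a : Letter Q Λ) : mwt A [a] = letterWt A a := by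
  rw [mwt, mwt, WtMat.mul_one]

theorem mwtOut_lt_top (A : WFA Q Λ) {w : Word Q Λ} {s : State Q} :
    mwtOut A w s < ⊤ ↔ ∃ t, mwt A w s t ≠ ⊤ := by
  rw [lt_top_iff_ne_top, mwtOut, ne_eq, Finset.inf_eq_top_iff]
  simp only [Finset.mem_univ, true_imp_iff, not_forall, ne_eq]

theorem mwtOut_eq_top (A : WFA Q Λ) {w : Word Q Λ} {s : State Q} :
    mwtOut A w s = ⊤ ↔ ∀ t, mwt A w s t = ⊤ := by
  rw [mwtOut, Finset.inf_eq_top_iff]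
  simp

theorem WtMat.TagDet.mul {m m' : WtMat Q} (h : m.TagDet) (h' : m'.TagDet) :
    (WtMat.mul m m').TagDet := by
  intro s s' t t' hs h1 h2
  obtain ⟨r, hr1, hr2⟩ := WtMat.mul_ne_top.1 h1
  obtain ⟨r', hr1', hr2'⟩ := WtMat.mul_ne_top.1 h2
  exact h' _ _ _ _ (h _ _ _ _ hs hr1 hr1') hr2 hr2'

theorem subWt_ne_top {a c : WithTop ℤ} : subWt a c ≠ ⊤ ↔ a ≠ ⊤ ∧ c ≠ ⊤ := by
  induction c with
  | top => simp [subWt]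
  | coe c => simp [subWt]

theorem baseMat_ne_top (A : WFA Q Λ) {p q : Q} {σ : Λ} {s t : State Q} :
    baseMat A p σ q s t ≠ ⊤ ↔ s.base = p ∧ t.tag = (q, A.succ s.reach σ) ∧
      A.wt s.inner σ t.inner ≠ ⊤ ∧ A.wt p σ q ≠ ⊤ := by
  rw [Prod.ext_iff]
  change _ ↔ _ ∧ (t.base = q ∧ t.reach = A.succ s.reach σ) ∧ _
  unfold baseMat
  split_ifs with h
  · rw [subWt_ne_top]
    tauto
  · simp only [ne_eq, not_true_eq_false, false_iff]
    tauto

theorem cactus_mem_of_ne_top (A : WFA Q Λ) {S' : Set (State Q)} {w : Word Q Λ} {s t : State Q}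
    (h : letterWt A (.cactus S' w) s t ≠ ⊤) : s ∈ S' ∧ t ∈ S' := by
  rw [letterWt_cactus_ne_top] at h
  exact ⟨h.1, h.2.1⟩

theorem IsBoundedCactus.tagDet {A : WFA Q Λ} {L : ℕ → ℕ} {a : Letter Q Λ}
    (h : IsBoundedCactus A L a) : (letterWt A a).TagDet := by
  intro s s' t t' hs h1 h2
  cases h with
  | base p σ q =>
    rw [letterWt, baseMat_ne_top] at h1 h2
    rw [h1.2.1, h2.2.1]
    exact congrArg (fun x => (q, A.succ x σ)) (congrArg Prod.snd hs)
  | cactus S' w _ _ hst _ =>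
    obtain ⟨⟨⟨q, T, -, rfl⟩, -⟩, -⟩ := hst
    rw [mem_fiber_iff.1 (cactus_mem_of_ne_top A h1).2,
      mem_fiber_iff.1 (cactus_mem_of_ne_top A h2).2]

theorem tagDet_mwt {A : WFA Q Λ} {L : ℕ → ℕ} {w : Word Q Λ}
    (h : ∀ a ∈ w, IsBoundedCactus A L a) : (mwt A w).TagDet := by
  induction w with
  | nil => rw [mwt]; exact WtMat.tagDet_one
  | cons a w ih =>
    rw [mwt]
    exact (h a (by simp)).tagDet.mul (ih fun b hb => h b (List.mem_cons_of_mem _ hb))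

/-- Transitions between baseline states have nonpositive weight: a base letter normalises them to
`0`, and on a cactus letter the baseline state is a minimal reflexive state with a cycle of
weight `0`. -/
theorem IsBoundedCactus.baseline_le {A : WFA Q Λ} {L : ℕ → ℕ} {a : Letter Q Λ}
    (h : IsBoundedCactus A L a) {s t : State Q} (hs : s.IsBaseline) (ht : t.IsBaseline)
    (hne : letterWt A a s t ≠ ⊤) : letterWt A a s t ≤ 0 := by
  classical
  cases h with
  | base p σ q =>
    rw [letterWt] at hne ⊢
    obtain ⟨h1, h2, h3, h4⟩ := (baseMat_ne_top A).1 hne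
    have h5 : t.base = q := congrArg Prod.fst h2
    have h6 : t.reach = A.succ s.reach σ := congrArg Prod.snd h2
    rw [baseMat, if_pos ⟨h1, h5, h6⟩, hs, ht, h1, h5]
    obtain ⟨c, hc⟩ := WithTop.ne_top_iff_exists.1 h4
    rw [← hc]
    simp only [subWt]
    rw [← WithTop.coe_add]
    simp
  | cactus S' w _ _ hst _ =>
    obtain ⟨h1, h2⟩ := cactus_mem_of_ne_top A hne
    have hst' := hst
    obtain ⟨⟨⟨q, T, -, rfl⟩, -⟩, hmin⟩ := hst
    obtain rfl := State.eq_of_isBaseline hs ht (by rw [mem_fiber_iff.1 h1, mem_fiber_iff.1 h2])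
    obtain ⟨h3, h4⟩ := hmin s h1 hs (bigM Q)
    rw [letterWt_cactus, if_pos ⟨h1, h2⟩]
    refine (Finset.inf_le (Finset.mem_filter.2 ⟨Finset.mem_univ s, h3⟩)).trans ?_
    rw [h4]
    simp

/-! ### Unfolding cactus letters -/

mutual

/-- Replaces every cactus letter `α_{S',w}` in a letter by `w ^ (2𝔪)`, recursively. Rebase and jump
letters do not occur in bounded cactus letters; they are sent to the empty word. -/
def unfoldLetter : Letter Q Λ → Word Q Λ
  | .base p σ q => [.base p σ q]
  | .cactus _ w => wpow (unfoldWord w) (2 * bigM Q)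
  | .rebase _ _ _ _ => []
  | .jump _ _ _ => []

/-- Replaces every cactus letter `α_{S',w}` in a word by `w ^ (2𝔪)`, recursively. -/
def unfoldWord : List (Letter Q Λ) → Word Q Λ
  | [] => []
  | a :: w => unfoldLetter a ++ unfoldWord w

end

/-- A word of letters of the form `(p, σ, c, q)`. -/
def IsBaseWord (w : Word Q Λ) : Prop := ∀ a ∈ w, ∃ p σ q, a = Letter.base p σ q

mutual

theorem isBaseWord_unfoldLetter : ∀ a : Letter Q Λ, IsBaseWord (unfoldLetter a)
  | .base p σ q => by
    intro a ha
    rw [unfoldLetter, List.mem_singleton] at ha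
    exact ⟨p, σ, q, ha⟩
  | .cactus _ w => by
    intro a ha
    rw [unfoldLetter] at ha
    exact isBaseWord_unfoldWord w a (mem_of_mem_wpow ha)
  | .rebase _ _ _ _ => by
    intro a ha
    simp [unfoldLetter] at ha
  | .jump _ _ _ => by
    intro a ha
    simp [unfoldLetter] at ha

theorem isBaseWord_unfoldWord : ∀ w : List (Letter Q Λ), IsBaseWord (unfoldWord w)
  | [] => by
    intro a ha
    simp [unfoldWord] at ha
  | c :: w => by
    intro a ha
    rw [unfoldWord, List.mem_append] at ha
    rcases ha with ha | ha
    · exact isBaseWord_unfoldLetter c a ha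
    · exact isBaseWord_unfoldWord w a ha

end

/-- On base letters no reachable state is forgotten: all states with the tag of a reachable state
are reachable. -/
theorem IsBaseWord.reachable {A : WFA Q Λ} {w : Word Q Λ} (hw : IsBaseWord w) {s t : State Q}
    (h : mwt A w A.start s ≠ ⊤) (hst : t.tag = s.tag) : mwt A w A.start t ≠ ⊤ := by
  induction w using List.reverseRecOn generalizing s t with
  | nil =>
    have hs : A.start = s := by
      by_contra hne
      simp [mwt, WtMat.one, hne] at h
    subst hs
    rw [start_tag_reach A hst]
    exact h
  | append_singleton w a ih =>
    obtain ⟨p, σ, q, rfl⟩ := hw a (by simp)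
    obtain ⟨r, h1, h2⟩ := (mwt_append_ne_top A).1 h
    rw [mwt_singleton, letterWt, baseMat_ne_top] at h2
    obtain ⟨h3, h4, -, h6⟩ := h2
    have h7 : t.inner ∈ A.succ r.reach σ := by
      have : t.reach = A.succ r.reach σ := congrArg Prod.snd (hst.trans h4)
      rw [← this]
      exact t.2.1
    obtain ⟨p₁, hp₁, hwt⟩ := (Finset.mem_filter.1 h7).2
    -- The predecessor of `t` need not be `r`, but it has the same tag.
    let r' : State Q := ⟨(p₁, r.base, r.reach), hp₁, r.2.2⟩
    refine (mwt_append_ne_top A).2 ⟨r', ih (fun a ha => hw a (List.mem_append_left _ ha)) h1 rfl, ?_⟩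
    rw [mwt_singleton, letterWt, baseMat_ne_top]
    exact ⟨h3, hst.trans h4, hwt, h6⟩

theorem mwt_wpow_ne_top_of_imp (A : WFA Q Λ) {w w' : Word Q Λ}
    (h : ∀ s t, mwt A w s t ≠ ⊤ → mwt A w' s t ≠ ⊤) (n : ℕ) (s t : State Q)
    (hn : mwt A (wpow w n) s t ≠ ⊤) : mwt A (wpow w' n) s t ≠ ⊤ := by
  induction n generalizing s with
  | zero => exact hn
  | succ n ih =>
    rw [wpow_succ, mwt_append_ne_top] at hn ⊢
    obtain ⟨r, h1, h2⟩ := hn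
    exact ⟨r, h s r h1, ih r h2⟩

theorem mwt_pow_two_bigM_of_cactus (A : WFA Q Λ) {S' : Set (State Q)} {w : Word Q Λ} {s t : State Q}
    (h : letterWt A (.cactus S' w) s t ≠ ⊤) : mwt A (wpow w (2 * bigM Q)) s t ≠ ⊤ := by
  rw [letterWt_cactus_ne_top] at h
  obtain ⟨-, -, g, -, h1, h2⟩ := h
  rw [mwt_wpow] at h1 h2 ⊢
  rw [two_mul]
  exact WtMat.pow_add_ne_top h1 h2

theorem unfoldWord_ne_top_of_forall (A : WFA Q Λ) {w : Word Q Λ}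
    (h : ∀ a ∈ w, ∀ s t, letterWt A a s t ≠ ⊤ → mwt A (unfoldLetter a) s t ≠ ⊤) (s t : State Q)
    (hst : mwt A w s t ≠ ⊤) : mwt A (unfoldWord w) s t ≠ ⊤ := by
  induction w generalizing s with
  | nil => simpa [unfoldWord] using hst
  | cons a w ih =>
    rw [mwt, WtMat.mul_ne_top] at hst
    obtain ⟨r, h1, h2⟩ := hst
    rw [unfoldWord, mwt_append_ne_top]
    exact ⟨r, h a (by simp) s r h1, ih (fun b hb => h b (List.mem_cons_of_mem _ hb)) r h2⟩

theorem IsBoundedCactus.unfold_ne_top {A : WFA Q Λ} {L : ℕ → ℕ} {a : Letter Q Λ}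
    (h : IsBoundedCactus A L a) (s t : State Q) (hst : letterWt A a s t ≠ ⊤) :
    mwt A (unfoldLetter a) s t ≠ ⊤ := by
  induction h generalizing s t with
  | base p σ q => rwa [unfoldLetter, mwt_singleton]
  | cactus S' w _ _ _ _ ih =>
    rw [unfoldLetter]
    exact mwt_wpow_ne_top_of_imp A (unfoldWord_ne_top_of_forall A ih) _ s t
      (mwt_pow_two_bigM_of_cactus A hst)

theorem unfoldWord_ne_top {A : WFA Q Λ} {L : ℕ → ℕ} {w : Word Q Λ}
    (h : ∀ a ∈ w, IsBoundedCactus A L a) (s t : State Q)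
    (hst : mwt A w s t ≠ ⊤) : mwt A (unfoldWord w) s t ≠ ⊤ :=
  unfoldWord_ne_top_of_forall A (fun a ha => (h a ha).unfold_ne_top) s t hst

end

/-! ### A witness from the unfolding of a single cactus letter -/

section

variable {Q Λ : Type*} [Fintype Q] [DecidableEq Q]

theorem wpow_add {α : Type*} (w : List α) (m n : ℕ) : wpow w (m + n) = wpow w m ++ wpow w n := by
  rw [wpow, List.replicate_add, List.flatten_append, wpow, wpow]

theorem mem_reachSet_start (A : WFA Q Λ) {w : Word Q Λ} {t : State Q} :
    t ∈ reachSet A {A.start} w ↔ mwt A w A.start t ≠ ⊤ := by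
  simp [reachSet]

theorem bddCac_of_mem_cactus {A : WFA Q Λ} {L : ℕ → ℕ} {S' : Set (State Q)} {w : Word Q Λ}
    (h : .cactus S' w ∈ bddCac A L) : ∀ a ∈ w, a ∈ bddCac A L := by
  intro a ha
  obtain ⟨h1, h2⟩ := h
  rw [Letter.depth] at h2
  have := depth_le_wordDepth ha
  cases h1 with
  | cactus _ _ h3 _ _ _ => exact ⟨h3 a ha, by omega⟩

theorem isStableCycle_of_bddCac {A : WFA Q Λ} {L : ℕ → ℕ} {S' : Set (State Q)} {w : Word Q Λ}
    (h : .cactus S' w ∈ bddCac A L) : IsStableCycle A S' w := by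
  cases h.1 with
  | cactus _ _ _ _ h3 _ => exact h3

theorem isBounded_of_bddCac {A : WFA Q Λ} {L : ℕ → ℕ} {w : Word Q Λ}
    (h : ∀ a ∈ w, a ∈ bddCac A L) : ∀ a ∈ w, IsBoundedCactus A L a := fun a ha => (h a ha).1

theorem IsBaseWord.bddCac {A : WFA Q Λ} {L : ℕ → ℕ} {w : Word Q Λ} (h : IsBaseWord w) :
    ∀ a ∈ w, a ∈ bddCac A L := by
  intro a ha
  obtain ⟨p, σ, q, rfl⟩ := h a ha
  exact ⟨.base p σ q, by simp [Letter.depth]⟩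

/-- Suppose that replacing one cactus letter `α_{S₁,w}` by `w ^ (2𝔪)` makes the suffix `z` readable.
By pumping, the sets of states reached after `p w ^ (2𝔪 k)`, `k ≥ 1`, increase with `k`, so that
they are constant from some `k` on; with this `k`, the words `p w ^ (2𝔪 k)`, `w` and `z` form a
witness. The additional copies of `w` do not make `z` readable after `α_{S₁,w}`, since a minimal
reflexive state reached by `w ^ (𝔪 j)` is already reached by `w ^ 𝔪`. -/
theorem exists_witness_of_unfold [Fintype Λ] {A : WFA Q Λ} {b : ℕ}
    {p z w : Word Q Λ} {S₁ : Set (State Q)} (hp : ∀ a ∈ p, a ∈ bddCac A (simpL A b))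
    (hα : .cactus S₁ w ∈ bddCac A (simpL A b)) (hz : z ∈ suffixWords A b)
    (hread : ∃ s t, mwt A p A.start s ≠ ⊤ ∧ letterWt A (.cactus S₁ w) s t ≠ ⊤)
    (htop : mwtOut A (p ++ [.cactus S₁ w] ++ z) A.start = ⊤)
    (hfin : mwtOut A (p ++ wpow w (2 * bigM Q) ++ z) A.start < ⊤) :
    ∃ w₁ S₁ w₂ w₃, IsWitnessZero A b w₁ S₁ w₂ w₃ := by
  have hst := isStableCycle_of_bddCac hα
  obtain ⟨⟨⟨q, T, -, rfl⟩, hcyc⟩, -⟩ := hst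
  obtain ⟨s₀, t₀, hs₀, ht₀⟩ := hread
  have hs₀' := mem_fiber_iff.1 (cactus_mem_of_ne_top A ht₀).1
  have hpS : ∀ s, mwt A p A.start s ≠ ⊤ → s ∈ fiber q T := fun s hs =>
    mem_fiber_iff.2 ((tagDet_mwt (isBounded_of_bddCac hp) _ _ _ _ rfl hs hs₀).trans hs₀')
  -- Pumping needs at least one copy of `w ^ (2𝔪)`, hence the shift by one.
  let X : ℕ → Set (State Q) := fun k =>
    reachSet A {A.start} (p ++ wpow w (2 * bigM Q * (k + 1)))
  have hX : ∀ k t, t ∈ X k ↔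
      ∃ s, mwt A p A.start s ≠ ⊤ ∧ WtMat.pow (mwt A w) (bigM Q * (2 * (k + 1))) s t ≠ ⊤ := by
    intro k t
    have e : 2 * bigM Q * (k + 1) = bigM Q * (2 * (k + 1)) := by ring
    rw [← mwt_wpow, ← e, ← mwt_append_ne_top, ← mem_reachSet_start]
  have hmono : Monotone X := monotone_nat_of_le_succ fun k t ht => by
    obtain ⟨s, h1, h2⟩ := (hX k t).1 ht
    exact (hX (k + 1) t).2 ⟨s, h1, WtMat.pow_bigM_pump (k := 2 * (k + 1)) (by omega) 2 h2⟩
  obtain ⟨K, hK⟩ := WellFoundedGT.monotone_chain_condition ⟨X, hmono⟩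
  have hKK : X K = X (K + 1) := hK (K + 1) (Nat.le_succ K)
  have hXS : ∀ t ∈ X K, t ∈ fiber q T := fun t ht => by
    obtain ⟨s, h1, h2⟩ := (hX K t).1 ht
    exact WtMat.mem_of_pow_ne_top (fun s hs t hst => hcyc ⟨s, hs, hst⟩) _ (hpS s h1) h2
  have e2 : 2 * bigM Q * (K + 1 + 1) = 2 * bigM Q * (K + 1) + 2 * bigM Q := by ring
  have e3 : p ++ wpow w (2 * bigM Q * (K + 1)) ++ wpow w (2 * bigM Q) =
      p ++ wpow w (2 * bigM Q * (K + 1 + 1)) := by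
    rw [e2, wpow_add, List.append_assoc]
  obtain ⟨t, ht⟩ := (mwtOut_lt_top A).1 hfin
  obtain ⟨r, hr, hrt⟩ := (mwt_append_ne_top A).1 ht
  have hr0 : r ∈ X 0 := by
    rw [← mem_reachSet_start] at hr
    simpa [X] using hr
  have hrK : r ∈ X K := hmono (Nat.zero_le K) hr0
  refine ⟨p ++ wpow w (2 * bigM Q * (K + 1)), fiber q T, w, z, ?_, ?_, hα, hz, ?_, ?_, ?_⟩
  · intro a ha
    rcases List.mem_append.1 ha with ha | ha
    · exact hp a ha
    · exact bddCac_of_mem_cactus hα a (mem_of_mem_wpow ha)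
  · ext t
    constructor
    · intro ht
      obtain ⟨h1, h2⟩ := ht
      obtain ⟨h3, h4⟩ := hXS r hrK
      exact ⟨r, hrK, h1.trans h3.symm, h2.trans h4.symm⟩
    · rintro ⟨r', hr', h1, h2⟩
      obtain ⟨h3, h4⟩ := hXS r' hr'
      exact ⟨h1.trans h3, h2.trans h4⟩
  · rw [e3]
    exact hKK
  · rw [e3, mwtOut_lt_top]
    exact ⟨t, (mwt_append_ne_top A).2 ⟨r,
      (mem_reachSet_start A).1 (hmono (Nat.zero_le (K + 1)) hr0), hrt⟩⟩
  · by_contra hne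
    obtain ⟨t, ht⟩ := (mwtOut_lt_top A).1 (lt_top_iff_ne_top.2 hne)
    obtain ⟨r, hr, hrt⟩ := (mwt_append_ne_top A).1 ht
    obtain ⟨s', hs', hs'r⟩ := (mwt_append_ne_top A).1 hr
    rw [mwt_singleton, letterWt_cactus_ne_top] at hs'r
    obtain ⟨-, hrS, g, hg, h1, h2⟩ := hs'r
    obtain ⟨s, hs, hss'⟩ := (hX K s').1 ((mem_reachSet_start A).2 hs')
    have hsg : mwt A (wpow w (bigM Q)) s g ≠ ⊤ := by
      have hgg := hg.1.2
      rw [mwt_wpow] at h1 hgg ⊢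
      refine WtMat.pow_bigM_of_loop (k := 2 * (K + 1) + 1) (bigM_pos A) hgg ?_
      rw [mul_add, mul_one]
      exact WtMat.pow_add_ne_top hss' h1
    refine absurd ((mwtOut_eq_top A).1 htop t) ?_
    refine (mwt_append_ne_top A).2 ⟨r, (mwt_append_ne_top A).2 ⟨s, hs, ?_⟩, hrt⟩
    rw [mwt_singleton, letterWt_cactus_ne_top]
    exact ⟨hpS s hs, hrS, g, hg, hsg, h2⟩

end

section

variable {Q Λ : Type*} [Fintype Q] [DecidableEq Q] [Fintype Λ]

theorem append_mem_suffixWords {A : WFA Q Λ} {b : ℕ} {w z : Word Q Λ}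
    (hw : ∀ a ∈ w, a ∈ bddCac A (simpL A b)) (hz : z ∈ suffixWords A b) :
    w ++ z ∈ suffixWords A b := by
  obtain ⟨z, a, rfl, hz, ha⟩ := hz
  refine ⟨w ++ z, a, by rw [List.append_assoc], fun e he => ?_, ha⟩
  rcases List.mem_append.1 he with he | he
  · exact Or.inl (Or.inl (hw e he))
  · exact hz e he

/-- Replacing the word `w` by `w'` after a prefix that allows to read `w` does not make any
unreadable admissible suffix readable. -/
def UnfoldsSilently (A : WFA Q Λ) (b : ℕ) (w w' : Word Q Λ) : Prop :=
  ∀ p z, (∀ a ∈ p, a ∈ bddCac A (simpL A b)) → z ∈ suffixWords A b →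
    (∃ t, mwt A (p ++ w) A.start t ≠ ⊤) → mwtOut A (p ++ w ++ z) A.start = ⊤ →
    mwtOut A (p ++ w' ++ z) A.start = ⊤

theorem UnfoldsSilently.append {A : WFA Q Λ} {b : ℕ} {w₁ w₁' w₂ w₂' : Word Q Λ}
    (h₁ : UnfoldsSilently A b w₁ w₁') (h₂ : UnfoldsSilently A b w₂ w₂')
    (hw₁' : IsBaseWord w₁') (hw₂ : ∀ a ∈ w₂, a ∈ bddCac A (simpL A b))
    (himp : ∀ s t, mwt A w₁ s t ≠ ⊤ → mwt A w₁' s t ≠ ⊤) :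
    UnfoldsSilently A b (w₁ ++ w₂) (w₁' ++ w₂') := by
  intro p z hp hz hread htop
  obtain ⟨t, ht⟩ := hread
  obtain ⟨r, hr, hrt⟩ := (mwt_append_ne_top A).1 ht
  obtain ⟨s, hs, hst⟩ := (mwt_append_ne_top A).1 hrt
  have h3 := h₁ p (w₂ ++ z) hp (append_mem_suffixWords hw₂ hz)
    ⟨s, (mwt_append_ne_top A).2 ⟨r, hr, hs⟩⟩ (by simpa only [List.append_assoc] using htop)
  have h4 := h₂ (p ++ w₁') z (fun a ha => by
      rcases List.mem_append.1 ha with ha | ha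
      · exact hp a ha
      · exact hw₁'.bddCac a ha) hz
    ⟨t, (mwt_append_ne_top A).2 ⟨s, (mwt_append_ne_top A).2 ⟨r, hr, himp _ _ hs⟩, hst⟩⟩
    (by simpa only [List.append_assoc] using h3)
  simpa only [List.append_assoc] using h4

theorem unfoldsSilently_nil (A : WFA Q Λ) (b : ℕ) : UnfoldsSilently A b [] [] :=
  fun _ _ _ _ _ h => h

theorem unfoldsSilently_word {A : WFA Q Λ} {b : ℕ} {w : Word Q Λ}
    (hw : ∀ a ∈ w, a ∈ bddCac A (simpL A b))
    (h : ∀ a ∈ w, UnfoldsSilently A b [a] (unfoldLetter a)) :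
    UnfoldsSilently A b w (unfoldWord w) := by
  induction w with
  | nil => exact unfoldsSilently_nil A b
  | cons a w ih =>
    rw [unfoldWord]
    refine UnfoldsSilently.append (w₁ := [a]) (h a (by simp))
      (ih (fun c hc => hw c (List.mem_cons_of_mem _ hc)) fun c hc => h c (List.mem_cons_of_mem _ hc))
      (isBaseWord_unfoldLetter a) (fun c hc => hw c (List.mem_cons_of_mem _ hc)) fun s t hst => ?_
    rw [mwt_singleton] at hst
    exact (hw a (by simp)).1.unfold_ne_top s t hst

theorem UnfoldsSilently.wpow {A : WFA Q Λ} {b : ℕ} {w : Word Q Λ}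
    (hw : ∀ a ∈ w, a ∈ Cactus.bddCac A (simpL A b))
    (h : UnfoldsSilently A b w (unfoldWord w)) (n : ℕ) :
    UnfoldsSilently A b (wpow w n) (wpow (unfoldWord w) n) := by
  induction n with
  | zero => exact unfoldsSilently_nil A b
  | succ n ih =>
    rw [wpow_succ, wpow_succ]
    exact h.append ih (isBaseWord_unfoldWord w) (fun a ha => hw a (mem_of_mem_wpow ha))
      (unfoldWord_ne_top (isBounded_of_bddCac hw))

/-- If there is no witness, every bounded cactus letter unfolds silently. -/
theorem unfoldsSilently_letter {A : WFA Q Λ} {b : ℕ}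
    (hno : ¬ ∃ w₁ S₁ w₂ w₃, IsWitnessZero A b w₁ S₁ w₂ w₃) {a : Letter Q Λ}
    (hb : IsBoundedCactus A (simpL A b) a) (ha : a.depth ≤ numStates Q - 1) :
    UnfoldsSilently A b [a] (unfoldLetter a) := by
  induction hb with
  | base p σ q =>
    rw [unfoldLetter]
    exact fun _ _ _ _ _ h => h
  | cactus S' w h1 h2 h3 h4 ih =>
    have hα : .cactus S' w ∈ bddCac A (simpL A b) := ⟨.cactus S' w h1 h2 h3 h4, ha⟩
    have hw := bddCac_of_mem_cactus hα
    have hsil := (unfoldsSilently_word hw fun a ha => ih a ha (hw a ha).2).wpow hw (2 * bigM Q)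
    rw [unfoldLetter]
    intro p z hp hz hread htop
    obtain ⟨t, ht⟩ := hread
    obtain ⟨r, hr, hrt⟩ := (mwt_append_ne_top A).1 ht
    have hrt' := hrt
    rw [mwt_singleton] at hrt
    refine hsil p z hp hz
      ⟨t, (mwt_append_ne_top A).2 ⟨r, hr, mwt_pow_two_bigM_of_cactus A hrt⟩⟩ ?_
    by_contra hne
    exact hno (exists_witness_of_unfold hp hα hz ⟨r, t, hr, hrt⟩ htop
      (lt_top_iff_ne_top.2 hne))

/-- A suffix that is unreadable after `u`, but readable from some state with the tag of a state
reached by `u`, gives rise to a witness: it is readable after the complete unfolding of `u`, which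
reaches all states with this tag. -/
theorem exists_witness_of_suffix {A : WFA Q Λ} {b : ℕ} {u z : Word Q Λ}
    (hu : ∀ a ∈ u, a ∈ bddCac A (simpL A b)) (hz : z ∈ suffixWords A b)
    (htop : mwtOut A (u ++ z) A.start = ⊤) {s r : State Q} (hs : mwt A u A.start s ≠ ⊤)
    (hr : r.tag = s.tag) (hrz : mwtOut A z r < ⊤) :
    ∃ w₁ S₁ w₂ w₃, IsWitnessZero A b w₁ S₁ w₂ w₃ := by
  by_contra hno
  have h1 := unfoldsSilently_word hu (fun a ha => unfoldsSilently_letter hno (hu a ha).1 (hu a ha).2)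
    [] z (by simp) hz ⟨s, hs⟩ htop
  obtain ⟨t, ht⟩ := (mwtOut_lt_top A).1 hrz
  have h2 := (isBaseWord_unfoldWord u).reachable
    (unfoldWord_ne_top (isBounded_of_bddCac hu) _ _ hs) hr
  exact (mwt_append_ne_top A).2 ⟨r, h2, ht⟩ ((mwtOut_eq_top A).1 h1 t)

end

/-! ### Rebasing a word on a run -/

section

variable {Q Λ : Type*}

theorem State.base_of_tag {s : State Q} {q : Q} {T : Finset Q} (h : s.tag = (q, T)) :
    s.base = q := congrArg Prod.fst h

theorem State.reach_of_tag {s : State Q} {q : Q} {T : Finset Q} (h : s.tag = (q, T)) :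
    s.reach = T := congrArg Prod.snd h

/-- `s'` is the state `s` (which has the tag of `ρ`) with its baseline component replaced by the
inner state of `ρ`. -/
structure IsRebased (ρ s s' : State Q) : Prop where
  tag_eq : s.tag = ρ.tag
  inner_eq : s'.inner = s.inner
  tag_eq' : s'.tag = (ρ.inner, ρ.reach)

theorem exists_isRebased {ρ s : State Q} (h : s.tag = ρ.tag) : ∃ s', IsRebased ρ s s' := by
  have h2 : s.reach = ρ.reach := State.reach_of_tag h
  exact ⟨⟨(s.inner, ρ.inner, ρ.reach), h2 ▸ s.2.1, ρ.2.1⟩, h, rfl, rfl⟩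

theorem exists_isRebased' {ρ s' : State Q} (h : s'.tag = (ρ.inner, ρ.reach)) :
    ∃ s, IsRebased ρ s s' := by
  have h2 : s'.reach = ρ.reach := State.reach_of_tag h
  exact ⟨⟨(s'.inner, ρ.base, ρ.reach), h2 ▸ s'.2.1, ρ.2.2⟩, rfl, rfl, h⟩

theorem IsRebased.eq_iff {ρ s s' t t' : State Q} (hs : IsRebased ρ s s') (ht : IsRebased ρ t t') :
    s' = t' ↔ s = t := by
  constructor
  · rintro rfl
    exact State.ext' (hs.inner_eq.symm.trans ht.inner_eq) (hs.tag_eq.trans ht.tag_eq.symm)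
  · rintro rfl
    exact State.ext' (hs.inner_eq.trans ht.inner_eq.symm) (hs.tag_eq'.trans ht.tag_eq'.symm)

/-- The matrix `m'` arises from `m` by making a transition `ρ → τ` of weight `c` the baseline: from
states with the tag of `ρ`, `m` leads only to states with the tag of `τ`, similarly for the rebased
states and `m'`, and the weights of corresponding transitions differ by `c`. -/
structure IsRebasedMat (ρ τ : State Q) (m m' : WtMat Q) (c : ℤ) : Prop where
  tag : ∀ s t, s.tag = ρ.tag → m s t ≠ ⊤ → t.tag = τ.tag
  tag' : ∀ s' t', s'.tag = (ρ.inner, ρ.reach) → m' s' t' ≠ ⊤ → t'.tag = (τ.inner, τ.reach)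
  wt : ∀ s s' t t', IsRebased ρ s s' → IsRebased τ t t' →
    m' s' t' = m s t + ((-c : ℤ) : WithTop ℤ)

variable [DecidableEq Q]

theorem isRebasedMat_one (ρ : State Q) : IsRebasedMat ρ ρ WtMat.one WtMat.one 0 := by
  have h1 : ∀ s t : State Q, WtMat.one s t ≠ ⊤ → s = t := by
    intro s t h
    by_contra hne
    simp [WtMat.one, hne] at h
  refine ⟨fun s t hs h => h1 s t h ▸ hs, fun s t hs h => h1 s t h ▸ hs, ?_⟩
  intro s s' t t' hs ht
  simp only [WtMat.one, hs.eq_iff ht]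
  simp

variable [Fintype Q]

theorem IsRebasedMat.mul {ρ σ τ : State Q} {m m' n n' : WtMat Q} {c d : ℤ}
    (h : IsRebasedMat ρ σ m m' c) (h' : IsRebasedMat σ τ n n' d) :
    IsRebasedMat ρ τ (WtMat.mul m n) (WtMat.mul m' n') (c + d) := by
  refine ⟨?_, ?_, ?_⟩
  · intro s t hs hst
    obtain ⟨r, h1, h2⟩ := WtMat.mul_ne_top.1 hst
    exact h'.tag r t (h.tag s r hs h1) h2
  · intro s t hs hst
    obtain ⟨r, h1, h2⟩ := WtMat.mul_ne_top.1 hst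
    exact h'.tag' r t (h.tag' s r hs h1) h2
  · intro s s' t t' hs ht
    have key : ∀ r r', IsRebased σ r r' →
        m' s' r' + n' r' t' = m s r + n r t + ((-(c + d) : ℤ) : WithTop ℤ) := by
      intro r r' hr
      rw [h.wt s s' r r' hs hr, h'.wt r r' t t' hr ht, neg_add, WithTop.coe_add]
      abel
    refine le_antisymm ?_ ?_
    · obtain ⟨r, hr⟩ := WtMat.exists_mul_eq m n s t
      by_cases hne : WtMat.mul m n s t = ⊤
      · rw [hne, WithTop.top_add]
        exact le_top
      · have hne' := hne
        rw [hr] at hne'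
        obtain ⟨r', hr'⟩ := exists_isRebased (h.tag s r hs.tag_eq (WithTop.add_ne_top.1 hne').1)
        rw [hr, ← key r r' hr']
        exact WtMat.mul_le _ _ _ _ _
    · obtain ⟨r', hr'⟩ := WtMat.exists_mul_eq m' n' s' t'
      by_cases hne : WtMat.mul m' n' s' t' = ⊤
      · rw [hne]
        exact le_top
      · have hne' := hne
        rw [hr'] at hne'
        obtain ⟨r, hr⟩ := exists_isRebased' (h.tag' s' r' hs.tag_eq' (WithTop.add_ne_top.1 hne').1)
        rw [hr', key r r' hr]
        exact add_le_add (WtMat.mul_le _ _ _ _ _) le_rfl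

theorem IsRebasedMat.pow {ρ : State Q} {m m' : WtMat Q} {c : ℤ} (h : IsRebasedMat ρ ρ m m' c)
    (n : ℕ) : IsRebasedMat ρ ρ (WtMat.pow m n) (WtMat.pow m' n) (n * c) := by
  induction n with
  | zero => simpa [WtMat.pow_zero] using isRebasedMat_one ρ
  | succ n ih =>
    have := h.mul ih
    have e : ((n + 1 : ℕ) : ℤ) * c = c + n * c := by push_cast; ring
    rw [e]
    exact this

theorem isRebasedMat_base (A : WFA Q Λ) {p q : Q} {σ : Λ} {ρ τ : State Q} {c : ℤ}
    (h : baseMat A p σ q ρ τ = c) :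
    IsRebasedMat ρ τ (baseMat A p σ q) (baseMat A ρ.inner σ τ.inner) c := by
  have hne : baseMat A p σ q ρ τ ≠ ⊤ := by rw [h]; exact WithTop.coe_ne_top
  obtain ⟨h1, h2, h3, h4⟩ := (baseMat_ne_top A).1 hne
  have h5 : τ.base = q := State.base_of_tag h2
  have h6 : τ.reach = A.succ ρ.reach σ := State.reach_of_tag h2
  refine ⟨?_, ?_, ?_⟩
  · intro s t hs hst
    have hs2 : s.reach = ρ.reach := State.reach_of_tag hs
    rw [((baseMat_ne_top A).1 hst).2.1, h2, hs2]
  · intro s t hs hst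
    have hs2 : s.reach = ρ.reach := State.reach_of_tag hs
    rw [((baseMat_ne_top A).1 hst).2.1, h6, hs2]
  · intro s s' t t' hs ht
    have s1 : s.base = ρ.base := State.base_of_tag hs.tag_eq
    have s2 : s.reach = ρ.reach := State.reach_of_tag hs.tag_eq
    have s3 : s'.base = ρ.inner := State.base_of_tag hs.tag_eq'
    have s4 : s'.reach = ρ.reach := State.reach_of_tag hs.tag_eq'
    have t1 : t.base = τ.base := State.base_of_tag ht.tag_eq
    have t2 : t.reach = τ.reach := State.reach_of_tag ht.tag_eq
    have t3 : t'.base = τ.inner := State.base_of_tag ht.tag_eq'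
    have t4 : t'.reach = τ.reach := State.reach_of_tag ht.tag_eq'
    rw [baseMat, if_pos ⟨h1, h5, h6⟩] at h
    rw [baseMat, baseMat, if_pos ⟨s3, t3, by rw [s4, t4, h6]⟩,
      if_pos ⟨s1.trans h1, t1.trans h5, by rw [s2, t2, h6]⟩, hs.inner_eq, ht.inner_eq]
    obtain ⟨a, ha⟩ := WithTop.ne_top_iff_exists.1 h3
    obtain ⟨e, he⟩ := WithTop.ne_top_iff_exists.1 h4
    rw [← ha, ← he] at h
    rw [← ha, ← he]
    simp only [subWt] at h ⊢
    norm_cast at h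
    subst h
    rw [add_assoc, ← WithTop.coe_add]
    congr 2
    ring

theorem isRebasedMat_cactus (A : WFA Q Λ) {S' : Set (State Q)} {w : Word Q Λ} {q : Q}
    {T : Finset Q} (hS : S' = fiber q T) {ρ τ : State Q} {c : ℤ}
    (h : letterWt A (.cactus S' w) ρ τ = c) :
    IsRebasedMat ρ τ (letterWt A (.cactus S' w)) (letterWt A (.rebase S' w ρ τ)) c := by
  have hmem := cactus_mem_of_ne_top A (show letterWt A (.cactus S' w) ρ τ ≠ ⊤ by
    rw [h]; exact WithTop.coe_ne_top)
  rw [hS, mem_fiber_iff, mem_fiber_iff] at hmem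
  have hρτ : ρ.tag = τ.tag := hmem.1.trans hmem.2.symm
  have hρτb : ρ.base = τ.base := State.base_of_tag hρτ
  have hρτr : ρ.reach = τ.reach := State.reach_of_tag hρτ
  refine ⟨?_, ?_, ?_⟩
  · intro s t _ hst
    have := (cactus_mem_of_ne_top A hst).2
    rw [hS, mem_fiber_iff] at this
    rw [this, hmem.2]
  · intro s t _ hst
    rw [letterWt, rebaseMat] at hst
    split_ifs at hst with hc
    · exact Prod.ext hc.2.2.2 (hc.2.1.trans hρτr)
    · exact absurd rfl hst
  · intro s s' t t' hs ht
    have s4 : s'.reach = ρ.reach := State.reach_of_tag hs.tag_eq'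
    have t4 : t'.reach = ρ.reach := (State.reach_of_tag ht.tag_eq').trans hρτr.symm
    have e : letterWt A (.rebase S' w ρ τ) = rebaseMat ρ τ (letterWt A (.cactus S' w)) := by
      rw [letterWt, letterWt]
    rw [e, rebaseMat, dif_pos ⟨s4, t4, State.base_of_tag hs.tag_eq',
      State.base_of_tag ht.tag_eq'⟩]
    have e1 : s'.withBase ρ.base (s4.symm ▸ ρ.2.2) = s :=
      State.ext' hs.inner_eq
        ((show (s'.withBase ρ.base (s4.symm ▸ ρ.2.2)).tag = ρ.tag from Prod.ext rfl s4).trans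
          hs.tag_eq.symm)
    have e2 : t'.withBase ρ.base (t4.symm ▸ ρ.2.2) = t :=
      State.ext' ht.inner_eq
        ((show (t'.withBase ρ.base (t4.symm ▸ ρ.2.2)).tag = ρ.tag from Prod.ext rfl t4).trans
          (hρτ.trans ht.tag_eq.symm))
    rw [e1, e2, h]
    rfl

/-- A word over the bounded cactus letters can be rebased on any of its runs: base letters are
exchanged for other base letters and cactus letters for rebase letters. -/
theorem IsRun.exists_rebased {A : WFA Q Λ} {L : ℕ → ℕ} {ρ τ : State Q} {w : Word Q Λ} {c : ℤ}
    (h : IsRun A ρ w c τ) (hw : ∀ a ∈ w, a ∈ bddCac A L) :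
    ∃ w' : Word Q Λ, (∀ a ∈ w', a ∈ bddCacReb A L) ∧ w'.length = w.length ∧
      wordDepth w' = wordDepth w ∧ IsRebasedMat ρ τ (mwt A w) (mwt A w') c := by
  induction h with
  | nil s => exact ⟨[], by simp, rfl, rfl, by simpa [mwt] using isRebasedMat_one s⟩
  | @cons s r t a w c d h1 h2 ih =>
    obtain ⟨w', hw', hlen, hdep, hmat⟩ := ih fun b hb => hw b (List.mem_cons_of_mem _ hb)
    obtain ⟨a', ha', hdepa, hmata⟩ : ∃ a' : Letter Q Λ, a' ∈ bddCacReb A L ∧ a'.depth = a.depth ∧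
        IsRebasedMat s r (letterWt A a) (letterWt A a') c := by
      obtain ⟨hb, hd⟩ := hw a (by simp)
      have hb' := hb
      cases hb with
      | base p σ q =>
        rw [letterWt] at h1 ⊢
        exact ⟨.base s.inner σ r.inner, Or.inl ⟨.base _ _ _, by simp [Letter.depth]⟩,
          by simp [Letter.depth], by rw [letterWt]; exact isRebasedMat_base A h1⟩
      | cactus S' w _ _ hst _ =>
        obtain ⟨⟨⟨q, T, -, hS⟩, -⟩, -⟩ := hst
        refine ⟨.rebase S' w s r, Or.inr ⟨S', w, s, r, rfl, ⟨hb', hd⟩, ?_⟩,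
          by rw [Letter.depth, Letter.depth], isRebasedMat_cactus A hS h1⟩
        rw [← letterWt_cactus_ne_top, h1]
        exact WithTop.coe_ne_top
    refine ⟨a' :: w', ?_, by simp [hlen], by rw [wordDepth, wordDepth, hdep, hdepa], ?_⟩
    · intro b hb
      rcases List.mem_cons.1 hb with rfl | hb
      · exact ha'
      · exact hw' b hb
    · rw [mwt, mwt]
      exact hmata.mul hmat

end

/-! ### Cycles through reachable states -/

section

variable {Q Λ : Type*} [Fintype Q] [DecidableEq Q]

theorem IsRun.le_maxeff {A : WFA Q Λ} {s t : State Q} {w : Word Q Λ} {c : ℤ}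
    (h : IsRun A s w c t) : c ≤ maxeff A w := by
  induction h with
  | nil s => simp [maxeff]
  | @cons s r t a w c d h1 _ ih =>
    have h2 : c.natAbs ≤ wmax A a := by
      have := Finset.le_sup (f := fun st : State Q × State Q =>
        (WithTop.untopD 0 (letterWt A a st.1 st.2)).natAbs) (Finset.mem_univ (s, r))
      rw [h1] at this
      exact this
    have h3 : maxeff A (a :: w) = wmax A a + maxeff A w := by simp [maxeff]
    rw [h3]
    push_cast
    omega

section Separated

variable {A : WFA Q Λ} {G : ℕ} {u x y : Word Q Λ} {ℓ : ℕ} {V : Fin ℓ → Set (State Q)}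
  {kx ky : Fin ℓ → ℤ}

theorem IsSeparatedPartition.gap_of_lt (h : IsSeparatedPartition A G u x y ℓ V kx ky)
    {ξ : Word Q Λ} (hξ : ξ ∈ [u, u ++ x, u ++ x ++ y]) {i j : Fin ℓ} (hij : i < j)
    {s s' : State Q} (hs : s ∈ V i) (hs' : s' ∈ V j) :
    conf A ξ s + (G : WithTop ℤ) < conf A ξ s' := by
  obtain ⟨d, hd⟩ := Nat.exists_eq_add_of_lt (Fin.lt_def.1 hij)
  induction d generalizing j s' with
  | zero => exact h.gap i j hd s hs s' hs' ξ hξ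
  | succ d ih =>
    have hlt : (i : ℕ) + d + 1 < ℓ := by have := j.2; omega
    obtain ⟨r, hr⟩ := h.nonempty ⟨i + d + 1, hlt⟩
    have h1 := ih (j := ⟨i + d + 1, hlt⟩) (Fin.lt_def.2 (by simp only; omega)) hr rfl
    have h2 := h.gap ⟨i + d + 1, hlt⟩ j hd r hr s' hs' ξ hξ
    refine h1.trans (lt_of_le_of_lt ?_ h2)
    exact le_add_of_nonneg_right (by exact_mod_cast Nat.zero_le G)

/-- Since the gaps exceed the effect of `x` and no shift is negative, `x` cannot lead to a higher
class of the partition. -/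
theorem IsSeparatedPartition.step (h : IsSeparatedPartition A G u x y ℓ V kx ky)
    (hG : maxeff A x ≤ G) (hk : ∀ j, 0 ≤ kx j) (hsupp : supp (conf A (u ++ x)) = supp (conf A u))
    {j : Fin ℓ} {s t : State Q} (hs : s ∈ V j) {d : ℤ} (hst : mwt A x s t = d) :
    ∃ i ≤ j, t ∈ V i ∧ conf A u t ≤ conf A u s + (d : WithTop ℤ) := by
  have hsB : conf A u s ≠ ⊤ := by
    have : s ∈ supp (conf A u) := h.union ▸ Set.mem_iUnion.2 ⟨j, hs⟩
    exact this
  obtain ⟨a, ha⟩ := WithTop.ne_top_iff_exists.1 hsB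
  have hle : conf A (u ++ x) t ≤ conf A u s + (d : WithTop ℤ) := by
    rw [conf, mwt_append, ← hst]
    exact WtMat.mul_le _ _ _ _ _
  have htx : conf A (u ++ x) t ≠ ⊤ := by
    refine ne_top_of_le_ne_top ?_ hle
    rw [← ha, ← WithTop.coe_add]
    exact WithTop.coe_ne_top
  have htB : t ∈ supp (conf A u) := hsupp ▸ htx
  obtain ⟨i, hi⟩ := Set.mem_iUnion.1 (h.union.symm ▸ htB)
  obtain ⟨e, he⟩ := WithTop.ne_top_iff_exists.1 (show conf A u t ≠ ⊤ from htB)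
  have hd := (exists_isRun_of_mwt A hst).le_maxeff
  have hkj := hk j
  have hki := hk i
  refine ⟨i, ?_, hi, ?_⟩
  · by_contra hij
    have hgap := h.gap_of_lt (ξ := u ++ x) (by simp) (lt_of_not_ge hij) hs hi
    have := lt_of_lt_of_le hgap hle
    rw [h.shift_x j s hs, ← ha] at this
    have h' : ((a + kx j + G : ℤ) : WithTop ℤ) < ((a + d : ℤ) : WithTop ℤ) := by
      push_cast
      exact this
    rw [WithTop.coe_lt_coe] at h'
    omega
  · rw [h.shift_x i t hi, ← ha, ← he] at hle
    rw [← ha, ← he]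
    norm_cast at hle ⊢
    omega

/-- No cycle through a state reached by `u` has negative weight on a power of `x`: it stays within
one class of the partition, where the configuration after `u` is a potential for the weights. -/
theorem IsSeparatedPartition.cycle_nonneg (h : IsSeparatedPartition A G u x y ℓ V kx ky)
    (hG : maxeff A x ≤ G) (hk : ∀ j, 0 ≤ kx j) (hsupp : supp (conf A (u ++ x)) = supp (conf A u))
    (n : ℕ) {s : State Q} (hs : s ∈ supp (conf A u)) {w : ℤ}
    (hw : WtMat.pow (mwt A x) n s s = w) : 0 ≤ w := by
  have key : ∀ (n : ℕ) (s t : State Q) (i j : Fin ℓ) (w : ℤ), s ∈ V j → t ∈ V i →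
      WtMat.pow (mwt A x) n s t = w →
      i ≤ j ∧ (i = j → conf A u t ≤ conf A u s + (w : WithTop ℤ)) := by
    intro n
    induction n with
    | zero =>
      intro s t i j w hs ht hw
      rw [WtMat.pow_zero, WtMat.one] at hw
      split_ifs at hw with hst
      · subst hst
        have hij : i = j := by
          by_contra hne
          exact Set.disjoint_left.1 (h.disjoint hne) ht hs
        refine ⟨hij.le, fun _ => ?_⟩
        rw [← hw, add_zero]
      · exact absurd hw.symm WithTop.coe_ne_top
    | succ n ih =>
      intro s t i j w hs ht hw
      obtain ⟨r, hr⟩ := WtMat.exists_mul_eq (mwt A x) (WtMat.pow (mwt A x) n) s t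
      rw [WtMat.pow_succ, hr] at hw
      obtain ⟨w1, w2, h1, h2, rfl⟩ := WithTop.add_eq_coe.1 hw
      obtain ⟨k, hkj, hrk, hle⟩ := h.step hG hk hsupp hs h1.symm
      obtain ⟨hik, himp⟩ := ih r t i k w2 hrk ht h2.symm
      refine ⟨hik.trans hkj, ?_⟩
      rintro rfl
      refine (himp (le_antisymm hik hkj)).trans ?_
      rw [WithTop.coe_add, ← add_assoc]
      exact add_le_add hle le_rfl
  obtain ⟨j, hj⟩ := Set.mem_iUnion.1 (h.union.symm ▸ hs)
  have h1 := (key n s s j j w hj hj hw).2 rfl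
  obtain ⟨a, ha⟩ := WithTop.ne_top_iff_exists.1 (show conf A u s ≠ ⊤ from hs)
  rw [← ha] at h1
  norm_cast at h1
  omega

end Separated

/-! ### The baseline run -/

theorem mwt_le_zero_of_steps (A : WFA Q Λ) (w : Word Q Λ) (ρ : ℕ → State Q)
    (h : ∀ (i : ℕ) (hi : i < w.length), letterWt A w[i] (ρ i) (ρ (i + 1)) ≤ 0) :
    mwt A w (ρ 0) (ρ w.length) ≤ 0 := by
  induction w generalizing ρ with
  | nil => simp [mwt, WtMat.one]
  | cons a w ih =>
    rw [mwt]
    refine (WtMat.mul_le _ _ _ (ρ 1) _).trans ?_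
    have h0 := h 0 (by simp)
    have h1 := ih (fun i => ρ (i + 1)) fun i hi => by
      have := h (i + 1) (by simpa using hi)
      simpa using this
    have := add_le_add h0 h1
    simpa using this

/-- The seamless baseline run yields a baseline state that is reached by `u` and has a cycle of
nonpositive weight on `x`. -/
theorem exists_baseline_cycle {A : WFA Q Λ} {L : ℕ → ℕ} {u x z : Word Q Λ}
    (hw : ∀ a ∈ u ++ x, a ∈ bddCac A L) (hsupp : supp (conf A (u ++ x)) = supp (conf A u))
    (h : HasSeamlessBaselineRun A (u ++ x ++ z)) :
    ∃ s, mwt A u A.start s ≠ ⊤ ∧ s.IsBaseline ∧ mwt A x s s ≤ 0 := by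
  obtain ⟨ρ, c, h0, hc0, hbase, hstep⟩ := h
  have hconf : ∀ i ≤ (u ++ x ++ z).length,
      mwt A ((u ++ x ++ z).take i) A.start (ρ i) ≠ ⊤ := by
    intro i hi
    rcases i with _ | i
    · simp [h0, mwt, WtMat.one]
    · rw [(hstep i (by omega)).2]
      exact WithTop.coe_ne_top
  have hu := hconf u.length (by simp)
  have hx := hconf (u ++ x).length (by simp)
  rw [List.append_assoc, List.take_left] at hu
  rw [List.take_left] at hx
  have hx' : mwt A u A.start (ρ (u ++ x).length) ≠ ⊤ := by
    have : ρ (u ++ x).length ∈ supp (conf A u) := hsupp ▸ hx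
    exact this
  have hub : ∀ a ∈ u, IsBoundedCactus A L a := fun a ha => (hw a (List.mem_append_left _ ha)).1
  have hb1 := hbase u.length (by simp)
  have hb2 := hbase (u ++ x).length (by simp)
  have heq : ρ u.length = ρ (u ++ x).length :=
    State.eq_of_isBaseline hb1 hb2 (tagDet_mwt hub _ _ _ _ rfl hu hx')
  refine ⟨ρ u.length, hu, hb1, ?_⟩
  have := mwt_le_zero_of_steps A x (fun i => ρ (u.length + i)) fun i hi => by
    have hlt : u.length + i < (u ++ x ++ z).length := by simp; omega
    obtain ⟨⟨d, hd, -⟩, -⟩ := hstep (u.length + i) hlt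
    have hget : (u ++ x ++ z)[u.length + i] = x[i] := by
      rw [List.getElem_append_left (by simp; omega), List.getElem_append_right (by omega)]
      simp
    rw [hget] at hd
    refine (hw x[i] (List.mem_append_right _ (List.getElem_mem hi))).1.baseline_le
      (hbase _ hlt.le) (hbase _ hlt) ?_
    change letterWt A x[i] _ (ρ (u.length + i + 1)) ≠ ⊤
    rw [hd]
    exact WithTop.coe_ne_top
  rw [add_zero, ← List.length_append, ← heq] at this
  exact this

/-! ### The witness from a cycle of negative weight -/

/-- Rebasing on a cycle of minimal slope produces a stable cycle. -/
theorem IsRebasedMat.isStableCycle {A : WFA Q Λ} {m : WtMat Q} {w : Word Q Λ} {r : State Q} {c : ℤ}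
    (h : IsRebasedMat r r m (mwt A w) c) (hr : m r r = c)
    (hmin : ∀ (k : ℕ) (s : State Q) (d : ℤ), s.tag = r.tag → WtMat.pow m k s s = d → k * c ≤ d) :
    IsStableCycle A (fiber r.inner r.reach) w := by
  refine ⟨⟨⟨_, _, r.2.1, rfl⟩, ?_⟩, ?_⟩
  · rintro t ⟨s, hs, hst⟩
    exact mem_fiber_iff.2 (h.tag' s t (mem_fiber_iff.1 hs) hst)
  · intro s hs hsb k
    have hs' := mem_fiber_iff.1 hs
    have hrs : IsRebased r r s := ⟨rfl, hsb.trans (State.base_of_tag hs'), hs'⟩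
    have hk := h.pow k
    have hle := WtMat.pow_self_le m k r c hr.le
    obtain ⟨d, hd⟩ := WithTop.ne_top_iff_exists.1 (ne_top_of_le_ne_top WithTop.coe_ne_top hle)
    have hd' : d = k * c := by
      refine le_antisymm ?_ (hmin k r d rfl hd.symm)
      rw [← hd] at hle
      exact WithTop.coe_le_coe.1 hle
    have h0 : mwt A (wpow w k) s s = 0 := by
      rw [mwt_wpow, hk.wt r s r s hrs hrs, ← hd, hd', ← WithTop.coe_add]
      simp
    refine ⟨⟨⟨hs, by rw [h0]; exact WithTop.zero_ne_top⟩, ?_⟩, h0⟩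
    rintro t' ⟨ht', hne⟩
    obtain ⟨t, ht⟩ := exists_isRebased' (mem_fiber_iff.1 ht')
    rw [h0]
    rw [mwt_wpow, hk.wt t t' t t' ht ht] at hne ⊢
    obtain ⟨e, he⟩ := WithTop.ne_top_iff_exists.1 (WithTop.add_ne_top.1 hne).1
    have := hmin k t e ht.tag_eq he.symm
    rw [← he, ← WithTop.coe_add]
    exact WithTop.coe_nonneg.2 (by omega)

theorem ghost_eq_fiber {A : WFA Q Λ} {L : ℕ → ℕ} {u : Word Q Λ}
    (hu : ∀ a ∈ u, IsBoundedCactus A L a) {s : State Q} (hs : mwt A u A.start s ≠ ⊤) :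
    ghost A u = fiber s.base s.reach := by
  ext t
  constructor
  · rintro ⟨r, hr, h1, h2⟩
    have h3 := tagDet_mwt hu _ _ _ _ rfl ((mem_reachSet_start A).1 hr) hs
    exact ⟨h1.trans (State.base_of_tag h3), h2.trans (State.reach_of_tag h3)⟩
  · rintro ⟨h1, h2⟩
    exact ⟨s, (mem_reachSet_start A).2 hs, h1, h2⟩

theorem IsBoundedCactus.mono {A : WFA Q Λ} {L L' : ℕ → ℕ} (hL : ∀ d, L d ≤ L' d) {a : Letter Q Λ}
    (h : IsBoundedCactus A L a) : IsBoundedCactus A L' a := by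
  induction h with
  | base p σ q => exact .base p σ q
  | cactus S' w _ h2 h3 h4 ih => exact .cactus S' w ih (h2.trans (hL _)) h3 h4

theorem bddCacReb_mono {A : WFA Q Λ} {L L' : ℕ → ℕ} (hL : ∀ d, L d ≤ L' d) :
    bddCacReb A L ⊆ bddCacReb A L' := by
  rintro a (⟨h1, h2⟩ | ⟨S', w, s, r, rfl, ⟨h1, h2⟩, h3⟩)
  · exact Or.inl ⟨h1.mono hL, h2⟩
  · exact Or.inr ⟨S', w, s, r, rfl, ⟨h1.mono hL, h2⟩, h3⟩

end

section

variable {Q Λ : Type*} [Fintype Q] [DecidableEq Q] [Fintype Λ]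

/-- If some cycle on a power of `x` has negative weight, but none through the states reached by `u`
has, then there is a witness. The suffix is a jump that makes the cycle of minimal slope the
baseline, followed by the cactus letter of the rebased power of `x`: it is readable only from
states from which a cycle of minimal slope can be reached. -/
theorem exists_witness_of_neg_cycle {A : WFA Q Λ} {b : ℕ} {u x : Word Q Λ}
    (hu : ∀ a ∈ u, a ∈ bddCac A (simpL A b)) (hx : ∀ a ∈ x, a ∈ bddCac A (simpL A b))
    (hlen : bigM Q * x.length ≤ simpL A b (wordDepth x + 1))
    {s : State Q} (hs : mwt A u A.start s ≠ ⊤)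
    (hcyc : ∀ t ∈ fiber s.base s.reach, ∀ t', mwt A x t t' ≠ ⊤ → t' ∈ fiber s.base s.reach)
    (hsupp : supp (conf A (u ++ x)) = supp (conf A u))
    (hpos : ∀ (n : ℕ), ∀ t ∈ supp (conf A u), ∀ w : ℤ, WtMat.pow (mwt A x) n t t = w → 0 ≤ w)
    (hneg : ∃ n, ∃ r ∈ fiber s.base s.reach, ∃ w : ℤ, WtMat.pow (mwt A x) n r r = w ∧ w < 0) :
    ∃ w₁ S₁ w₂ w₃, IsWitnessZero A b w₁ S₁ w₂ w₃ := by
  obtain ⟨r, hr, n₀, hn1, hnN, c, hc, hc0, hslope⟩ := WtMat.exists_min_slope hcyc hneg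
  have hrs : r.tag = s.tag := mem_fiber_iff.1 hr
  have hc' := hc
  rw [← mwt_wpow] at hc'
  obtain ⟨y, hy, hylen, hydep, hmat⟩ := (exists_isRun_of_mwt A hc').exists_rebased
    (L := simpL A b) fun a ha => hx a (mem_of_mem_wpow ha)
  have hmin : ∀ (k : ℕ) (t : State Q) (d : ℤ), t.tag = r.tag →
      WtMat.pow (mwt A (wpow x n₀)) k t t = d → k * c ≤ d := by
    intro k t d ht hd
    rw [mwt_wpow, ← WtMat.pow_mul] at hd
    have := hslope (n₀ * k) t (mem_fiber_iff.2 (ht.trans hrs)) d hd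
    have hn₀ : (0 : ℤ) < n₀ := by exact_mod_cast hn1
    refine le_of_mul_le_mul_left ?_ hn₀
    calc (n₀ : ℤ) * (k * c) = c * (n₀ * k : ℕ) := by push_cast; ring
      _ ≤ _ := this
  have hstable := hmat.isStableCycle hc' hmin
  -- The baseline state of the rebased cycle, to which the jump leads from `r`.
  let r' : State Q := ⟨(r.inner, r.inner, r.reach), r.2.1, r.2.1⟩
  have hr' : r' ∈ fiber r.inner r.reach := ⟨rfl, rfl⟩
  obtain ⟨hr'min, hr'0⟩ := hstable.2 r' hr' rfl (bigM Q)
  have hz : [.jump r.reach r.base r.inner] ++ [.cactus (fiber r.inner r.reach) y] ∈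
      suffixWords A b := by
    refine ⟨_, _, rfl, ?_, _, _, rfl, ?_, ?_, hstable⟩
    · intro e he
      rw [List.mem_singleton] at he
      exact Or.inr ⟨_, _, _, r.2.2, r.2.1, he⟩
    · exact fun a ha => bddCacReb_mono (simpL_le_genL A b) (hy a ha)
    · rw [hylen, hydep, length_wpow, wordDepth_wpow x hn1]
      exact ((Nat.mul_le_mul_right _ (hnN.trans numStates_le_bigM)).trans hlen).trans
        (simpL_le_genL A b _)
  refine exists_witness_of_suffix hu hz ?_ hs hrs ?_
  · rw [mwtOut_eq_top]
    intro t
    by_contra ht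
    obtain ⟨s₁, hs₁, ht⟩ := (mwt_append_ne_top A).1 ht
    obtain ⟨s₁', hjump, hcac⟩ := (mwt_append_ne_top A).1 ht
    rw [mwt_singleton, letterWt, jumpMat_ne_top] at hjump
    obtain ⟨hj1, hj2, hj3⟩ := hjump
    have hreb : IsRebased r s₁ s₁' := ⟨hj1, hj3.symm, hj2⟩
    rw [mwt_singleton, letterWt_cactus_ne_top] at hcac
    obtain ⟨-, -, g', hg', hsg, -⟩ := hcac
    obtain ⟨g, hg⟩ := exists_isRebased' (mem_fiber_iff.1 hg'.1.1)
    -- The suffix is grounded at `g'`, so the corresponding state `g`, which is reached by `u`, has a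
    -- cycle of weight at most `𝔪 * c < 0` on `x ^ (n₀ 𝔪)`.
    have hM := hmat.pow (bigM Q)
    rw [mwt_wpow, hM.wt s₁ s₁' g g' hreb hg, mwt_wpow, ← WtMat.pow_mul] at hsg
    have hgB : g ∈ supp (conf A u) := by
      refine WtMat.mem_of_pow_ne_top (fun t ht t' htt' => ?_) _ hs₁ (WithTop.add_ne_top.1 hsg).1
      rw [← hsupp]
      exact (mwt_append_ne_top A).2 ⟨t, ht, htt'⟩
    have hgne := hg'.1.2
    have hgle := hg'.2 r' hr'min.1
    rw [hr'0] at hgle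
    rw [mwt_wpow, hM.wt g g' g g' hg hg, mwt_wpow, ← WtMat.pow_mul] at hgne hgle
    obtain ⟨d, hd⟩ := WithTop.ne_top_iff_exists.1 (WithTop.add_ne_top.1 hgne).1
    have hd0 := hpos _ g hgB d hd.symm
    rw [← hd] at hgle
    norm_cast at hgle
    have h1 : ((bigM Q : ℕ) : ℤ) * c < 0 :=
      mul_neg_of_pos_of_neg (by exact_mod_cast bigM_pos A) hc0
    linarith
  · rw [mwtOut_lt_top]
    refine ⟨r', (mwt_append_ne_top A).2 ⟨r', ?_, ?_⟩⟩
    · rw [mwt_singleton, letterWt, jumpMat_ne_top]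
      exact ⟨rfl, rfl, rfl⟩
    · rw [mwt_singleton, letterWt_cactus_ne_top]
      exact ⟨hr', hr', r', hr'min, hr'min.1.2, hr'min.1.2⟩

end

end Cactus

theorem mainTheorem6 {Q Λ : Type*} [Fintype Q] [DecidableEq Q] [Fintype Λ] (A : Cactus.WFA Q Λ)
    (b : ℕ) (u x y v : Cactus.Word Q Λ) (h : Cactus.IsPositiveSSRI A b u x y v) :
    Cactus.IsStableCycle A (Cactus.ghost A u) x ∨
      ∃ w₁ S₁ w₂ w₃, Cactus.IsWitnessZero A b w₁ S₁ w₂ w₃ := by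
  open Cactus in
  obtain ⟨hS, ℓ, V, kx, ky, hV, hk⟩ := h
  have hux : ∀ a ∈ u ++ x, a ∈ bddCac A (simpL A b) := fun a ha =>
    hS.letters a (by simp only [List.mem_append] at ha ⊢; tauto)
  have hu : ∀ a ∈ u, a ∈ bddCac A (simpL A b) := fun a ha => hux a (List.mem_append_left _ ha)
  have hx : ∀ a ∈ x, a ∈ bddCac A (simpL A b) := fun a ha => hux a (List.mem_append_right _ ha)
  have hG : maxeff A x ≤ simpGap A x y := by
    have h1 : maxeff A x ≤ maxeff A (x ++ y) := by simp [maxeff]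
    refine h1.trans (Nat.le_mul_of_pos_left _ ?_)
    have := numStates_pos A
    have := bigM_pos A
    positivity
  have hpos : ∀ (n : ℕ), ∀ t ∈ supp (conf A u), ∀ w : ℤ,
      WtMat.pow (mwt A x) n t t = w → 0 ≤ w := fun n t ht w hw =>
    hV.cycle_nonneg hG (fun j => (hk j).1) hS.supp_x n ht hw
  obtain ⟨s, hs, hsb, hs0⟩ := exists_baseline_cycle (z := y ++ v) hux hS.supp_x
    (by simpa only [List.append_assoc] using hS.baseline)
  have hss : mwt A x s s ≠ ⊤ := ne_top_of_le_ne_top WithTop.zero_ne_top hs0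
  have hcyc : ∀ t ∈ fiber s.base s.reach, ∀ t', mwt A x t t' ≠ ⊤ → t' ∈ fiber s.base s.reach :=
    fun t ht t' htt' => mem_fiber_iff.2
      (tagDet_mwt (isBounded_of_bddCac hx) _ _ _ _ (mem_fiber_iff.1 ht) htt' hss)
  by_cases hneg : ∃ n, ∃ r ∈ fiber s.base s.reach, ∃ w : ℤ, WtMat.pow (mwt A x) n r r = w ∧ w < 0
  · refine Or.inr (exists_witness_of_neg_cycle hu hx ?_ hs hcyc hS.supp_x hpos hneg)
    have hlen := hS.length_x
    have hM : (0 : ℚ) < bigM Q := by exact_mod_cast bigM_pos A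
    rw [one_div, inv_mul_eq_div, le_div_iff₀ hM] at hlen
    have h' : x.length * bigM Q ≤ simpL A b (wordDepth x + 1) := by exact_mod_cast hlen
    rwa [mul_comm]
  · left
    push Not at hneg
    rw [ghost_eq_fiber (isBounded_of_bddCac hu) hs]
    refine ⟨⟨⟨_, _, s.2.2, rfl⟩, ?_⟩, ?_⟩
    · rintro t ⟨t', ht', htt'⟩
      exact hcyc t' ht' t htt'
    · intro s' hs' hs'b n
      obtain rfl : s' = s := State.eq_of_isBaseline hs'b hsb (mem_fiber_iff.1 hs')
      have hle := WtMat.pow_self_le (mwt A x) n s' 0 hs0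
      have hne := ne_top_of_le_ne_top WithTop.coe_ne_top hle
      obtain ⟨d, hd⟩ := WithTop.ne_top_iff_exists.1 hne
      have h0 : mwt A (wpow x n) s' s' = 0 := by
        rw [mwt_wpow]
        have h1 := hpos n s' hs d hd.symm
        rw [← hd] at hle ⊢
        have h2 := WithTop.coe_le_coe.1 hle
        have : d = 0 := by linarith
        rw [this]
        rfl
      refine ⟨⟨⟨hs', by rw [mwt_wpow]; exact hne⟩, ?_⟩, h0⟩
      rintro t ⟨ht, htne⟩
      rw [h0]
      rw [mwt_wpow] at htne ⊢
      obtain ⟨e, he⟩ := WithTop.ne_top_iff_exists.1 htne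
      rw [← he]
      exact WithTop.coe_nonneg.2 (hneg n t ht e he.symm)
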